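/- **Setting.** Let $d\ge 1$, $M\ge 0$ be integers and let $\mathcal X\subseteq\mathbb R^d$ have a Lebesgue-null boundary. The target $X^*\in\mathcal X$ and the vector $\epsilon^*=(\epsilon_1^*,\dots,\epsilon_M^*)\in(0,1/2)^M$ of unknown crossover probabilities have a joint prior density $p_0(x,\epsilon)$ on $\mathcal X\times(0,1/2)^M$ with finite differential entropy (for instance, $\epsilon^*$ uniform on $(0,1/2)^M$ and independent of $X^*$). At each time $n=0,1,2,\dots$ a controller chooses a joint query $\mathbf A_n=(A_n^{(1)},\dots,A_n^{(M)})$, where each $A_n^{(m)}$ is a finite union of half-open rectangles $[a_1,b_1)\times\dots\times[a_d,b_d)\subseteq\mathcal X$, and then receives responses $\mathbf Y_{n+1}\in\{0,1\}^M$. A policy $\zeta$ prescribes $\mathbf A_n$ as a function of $\mathbf Y_1,\dots,\mathbf Y_n$; let $\mathcal F_n=\sigma(\mathbf Y_1,\dots,\mathbf Y_n)$, and let $\mathbb P^\zeta$, $\mathbb E^\zeta$ be the probability and expectation under $\zeta$. The players answer conditionally independently through memoryless binary symmetric channels: for $\mathbf y\in\{0,1\}^M$, $$\mathbb P^\zeta(\mathbf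 Y_{n+1}=\mathbf y\mid X^*=x,\epsilon^*=\epsilon,\mathcal F_n)=\prod_{m=1}^M f_{I(x\in A_n^{(m)})}(y^{(m)}\mid\epsilon_m),\qquad f_j(y\mid e)=\begin{cases}1-e,&y=j,\\ e,&y\ne j.\end{cases}$$ Let $p_{n+1}(x,\epsilon)\propto \mathbb P^\zeta(\mathbf Y_{n+1}\mid X^*=x,\epsilon^*=\epsilon,\mathcal F_n)\,p_n(x,\epsilon)$ be the normalized Bayes recursion started at $p_0$. All logarithms are to base $2$; $H$ denotes differential entropy for densities of $(x,\epsilon)$ and Shannon entropy for probability mass functions on $\{0,1\}^M$. Write $g_{i}(\mathbf y\mid\epsilon)=\prod_m f_{i_m}(y^{(m)}\mid\epsilon_m)$ for $i\in\{0,1\}^M$, $B^1=B$, $B^0=B^c$, $P_n(R,\epsilon)=\int_R p_n(x,\epsilon)\,dx$, and $C(e)=1+e\log e+(1-e)\log(1-e)$ for the capacity of the channel. For a joint query $\mathbf A$ put $$G_n(\mathbf A)=H\Big(\sum_{i\in\{0,1\}^M}\int_{(0,1/2)^M} g_i(\cdot\mid\epsilon)\,P_n\Big(\bigcap_m (A^{(m)})^{i_m},\epsilon\Big)d\epsilon\Big)-\sum_{i\in\{0,1\}^M}\int_{(0,1/2)^M}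 H(g_i(\cdot\mid\epsilon))\,P_n\Big(\bigcap_m (A^{(m)})^{i_m},\epsilon\Big)d\epsilon ,$$ and let $G_n^*=\sup_{\mathbf A}\{H(p_n)-\mathbb E[H(p_{n+1})\mid\mathbf A_n=\mathbf A,\mathcal F_n]\}$ be the maximal expected entropy loss (information gain) at time $n$, where $\mathbb E[H(p_{n+1})\mid\mathbf A_n=\mathbf A,\mathcal F_n]$ is the average of the entropy of the Bayes update of $p_n$ over the responses to $\mathbf A$, weighted by their probabilities under $p_n$. **Theorem.** For every policy $\zeta$ and every $n$, $p_n$ is the conditional density of $(X^*,\epsilon^*)$ given $\mathcal F_n$, the quantity $H(p_n)-\mathbb E^\zeta[H(p_{n+1})\mid\mathcal F_n]$ is almost surely equal to the above expected entropy loss $H(p_n)-\mathbb E[H(p_{n+1})\mid\mathbf A_n=\mathbf A,\mathcal F_n]$ at the prescribed query $\mathbf A=\mathbf A_n$, and almost surely: 1. For every joint query $\mathbf A$ the expected entropy loss $H(p_n)-\mathbb E[H(p_{n+1})\mid\mathbf A_n=\mathbf A,\mathcal F_n]$ equals $G_n(\mathbf A)$, and hence $G_n^*=\sup_{\mathbf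 A}G_n(\mathbf A)$, a finite supremum. Moreover, for every horizon $N$, a policy $\zeta$ minimizes $\mathbb E^\zeta[H(p_N)]$ over all policies if and only if for each $n<N$ its query satisfies $G_n(\mathbf A_n)=G_n^*$ almost surely. 2. $G_n^*=\sum_{m=1}^M\mathbb E^\zeta[C(\epsilon_m^*)\mid\mathcal F_n]$, where $\mathbb E^\zeta[C(\epsilon_m^*)\mid\mathcal F_n]=\int_0^{1/2}C(t)\,p_n^{(m)}(t)\,dt$ and $p_n^{(m)}$ is the marginal density of $\epsilon_m$ under $p_n$. -/

import Mathlib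

open MeasureTheory Set

noncomputable section

/-- A vector of `M` binary responses (or of `M` binary channel inputs); `true` stands for `1`. -/
abbrev Resp (M : ℕ) : Type := Fin M → Bool

/-- The space of pairs `(x, ε)`: a target location and a vector of crossover probabilities. -/
abbrev Param (d M : ℕ) : Type := (Fin d → ℝ) × (Fin M → ℝ)

/-- The open cube `(0, 1/2)^M` of crossover probabilities. -/
def epsBox (M : ℕ) : Set (Fin M → ℝ) := {e | ∀ m, e m ∈ Ioo (0 : ℝ) (1 / 2)}

/-! ### Query regions -/

/-- The half-open rectangle `[a₁, b₁) × ⋯ × [a_d, b_d)`. -/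
def rect {d : ℕ} (a b : Fin d → ℝ) : Set (Fin d → ℝ) := {x | ∀ l, a l ≤ x l ∧ x l < b l}

/-- A query region: a finite union of half-open rectangles contained in the target domain `𝒳`. -/
def IsQueryRegion {d : ℕ} (𝒳 A : Set (Fin d → ℝ)) : Prop :=
  ∃ (J : ℕ) (a b : Fin J → Fin d → ℝ),
    (∀ j l, a j l ≤ b j l) ∧ (∀ j, rect (a j) (b j) ⊆ 𝒳) ∧ A = ⋃ j, rect (a j) (b j)

/-- A joint query: one query region for each of the `M` players. -/
abbrev JointQuery {d : ℕ} (𝒳 : Set (Fin d → ℝ)) (M : ℕ) : Type :=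
  Fin M → {A : Set (Fin d → ℝ) // IsQueryRegion 𝒳 A}

/-- The regions `A⁽¹⁾, …, A⁽ᴹ⁾` of a joint query, as sets. -/
def JointQuery.regions {d M : ℕ} {𝒳 : Set (Fin d → ℝ)} (A : JointQuery 𝒳 M) :
    Fin M → Set (Fin d → ℝ) := fun m => (A m : Set (Fin d → ℝ))

/-- A policy: the joint query at time `n` is a function of the responses received up to time `n`. -/
abbrev Policy {d : ℕ} (𝒳 : Set (Fin d → ℝ)) (M : ℕ) : Type :=
  (n : ℕ) → (Fin n → Resp M) → JointQuery 𝒳 M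

/-- The cell `⋂ₘ (A⁽ᵐ⁾)^{iₘ}` of the partition induced by `A`, with `B¹ = B` and `B⁰ = Bᶜ`. -/
def cell {d M : ℕ} (A : Fin M → Set (Fin d → ℝ)) (i : Resp M) : Set (Fin d → ℝ) :=
  ⋂ m, if i m = true then A m else (A m)ᶜ

/-! ### Binary symmetric channels -/

/-- `f_j(y | e)`: the law of the output of a BSC with crossover probability `e` and input `j`. -/
def bsc (e : ℝ) (j y : Bool) : ℝ := if y = j then 1 - e else e

/-- `g_{i₁:i_M}(y | ε) = ∏ₘ f_{iₘ}(y⁽ᵐ⁾ | εₘ)`. -/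
def bscProd {M : ℕ} (e : Fin M → ℝ) (i y : Resp M) : ℝ := ∏ m, bsc (e m) (i m) (y m)

open Classical in
/-- The true answers `I(x ∈ A⁽ᵐ⁾)` to the queries. -/
def answers {d M : ℕ} (A : Fin M → Set (Fin d → ℝ)) (x : Fin d → ℝ) : Resp M :=
  fun m => decide (x ∈ A m)

/-- The likelihood of the responses `y` to the queries `A` when the parameter is `(x, ε)`. -/
def likelihood {d M : ℕ} (A : Fin M → Set (Fin d → ℝ)) (y : Resp M) (θ : Param d M) : ℝ :=
  bscProd θ.2 (answers A θ.1) y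

/-- The capacity (in bits) of a BSC, `C(e) = 1 - h_b(e)`. -/
def bscCapacity (e : ℝ) : ℝ :=
  1 - (-(e * Real.logb 2 e) - (1 - e) * Real.logb 2 (1 - e))

/-! ### Entropies (in bits) -/

/-- Shannon entropy of a probability mass function on a finite set. -/
def shannonEntropy {α : Type*} [Fintype α] (q : α → ℝ) : ℝ := -∑ a, q a * Real.logb 2 (q a)

/-- Differential entropy of a joint density of `(x, ε)`. -/
def diffEntropy {d M : ℕ} (p : Param d M → ℝ) : ℝ := -∫ θ, p θ * Real.logb 2 (p θ)

/-! ### Posteriors -/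

/-- A prior density for `(X*, ε*)` on `𝒳 × (0, 1/2)^M` whose differential entropy is finite. -/
structure IsPriorDensity {d M : ℕ} (𝒳 : Set (Fin d → ℝ)) (p : Param d M → ℝ) : Prop where
  measurable : Measurable p
  nonneg : ∀ θ, 0 ≤ p θ
  eq_zero : ∀ θ, θ ∉ 𝒳 ×ˢ epsBox M → p θ = 0
  integral_eq_one : ∫ θ, p θ = 1
  entropy_finite : Integrable (fun θ => p θ * Real.logb 2 (p θ))

/-- The probability of the responses `y` to the queries `A` when `(X*, ε*)` has density `p`. -/
def predictive {d M : ℕ} (p : Param d M → ℝ) (A : Fin M → Set (Fin d → ℝ)) (y : Resp M) : ℝ :=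
  ∫ θ, likelihood A y θ * p θ

/-- Bayes' rule: the density of `(X*, ε*)` after the responses `y` to the queries `A`. -/
def bayesUpdate {d M : ℕ} (p : Param d M → ℝ) (A : Fin M → Set (Fin d → ℝ)) (y : Resp M) :
    Param d M → ℝ := fun θ => likelihood A y θ * p θ / predictive p A y

/-- The joint posterior density `pₙ` under the policy `ζ`, given the first `n` responses. -/
def jointPosterior {d M : ℕ} {𝒳 : Set (Fin d → ℝ)} (p₀ : Param d M → ℝ) (ζ : Policy 𝒳 M) :
    (n : ℕ) → (Fin n → Resp M) → Param d M → ℝ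
  | 0, _ => p₀
  | n + 1, h =>
      bayesUpdate (jointPosterior p₀ ζ n (Fin.init h)) (ζ n (Fin.init h)).regions (h (Fin.last n))

/-- The marginal density of `ε_m` when `(X*, ε*)` has density `p`. -/
def epsMarginal {d M : ℕ} (p : Param d M → ℝ) (m : Fin M) (t : ℝ) : ℝ :=
  ∫ x : Fin d → ℝ, ∫ η : {k : Fin M // k ≠ m} → ℝ,
    p (x, fun k => if hk : k = m then t else η ⟨k, hk⟩)

/-! ### Gains -/

/-- The expected entropy loss `H(pₙ) - E[H(pₙ₊₁) | Aₙ = A, pₙ = p]`. -/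
def entropyLoss {d M : ℕ} (p : Param d M → ℝ) (A : Fin M → Set (Fin d → ℝ)) : ℝ :=
  diffEntropy p - ∑ y : Resp M, predictive p A y * diffEntropy (bayesUpdate p A y)

/-- The maximal gain `G*`: the supremum over joint queries of the expected entropy loss. -/
def maxGain {d M : ℕ} (𝒳 : Set (Fin d → ℝ)) (p : Param d M → ℝ) : ℝ :=
  ⨆ A : JointQuery 𝒳 M, entropyLoss p A.regions

/-- `P(R, ε) = ∫_R p(x, ε) dx`. -/
def regionDensity {d M : ℕ} (p : Param d M → ℝ) (R : Set (Fin d → ℝ)) (e : Fin M → ℝ) : ℝ :=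
  ∫ x in R, p (x, e)

/-- The entropy-of-mixture formula
`H(∑ᵢ ∫ gᵢ(· | ε) P(⋂ₘ (A⁽ᵐ⁾)^{iₘ}, ε) dε) - ∑ᵢ ∫ H(gᵢ(· | ε)) P(⋂ₘ (A⁽ᵐ⁾)^{iₘ}, ε) dε`. -/
def mixtureGain {d M : ℕ} (p : Param d M → ℝ) (A : Fin M → Set (Fin d → ℝ)) : ℝ :=
  shannonEntropy (fun y : Resp M =>
      ∑ i : Resp M, ∫ e in epsBox M, bscProd e i y * regionDensity p (cell A i) e)
    - ∑ i : Resp M, ∫ e in epsBox M, shannonEntropy (bscProd e i) * regionDensity p (cell A i) e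

/-! ### The observed process -/

/-- The responses `Y₁, …, Yₙ` received up to time `n`. -/
def history {Ω : Type*} {M : ℕ} (Y : ℕ → Ω → Resp M) (n : ℕ) (ω : Ω) : Fin n → Resp M :=
  fun k => Y (k + 1) ω

/-- The information `𝓕ₙ` of the joint controller at time `n`: the σ-algebra generated by
`Y₁, …, Yₙ` (the queries are functions of these). -/
abbrev obs {Ω : Type*} {M : ℕ} (Y : ℕ → Ω → Resp M) (n : ℕ) : MeasurableSpace Ω :=
  MeasurableSpace.comap (history Y n) inferInstance

/-- `μ` is a law of the target `X`, the crossover probabilities `eps` and the responses `Y` under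
the policy `ζ`: the pair `(X, eps)` has density `p₀`, and given `(X, eps)` and the first `n`
responses, the players answer the joint query of time `n` independently of each other, player `m`
through a binary symmetric channel with crossover probability `eps m`. -/
structure IsPolicyLaw {d M : ℕ} {𝒳 : Set (Fin d → ℝ)} {Ω : Type*} [MeasurableSpace Ω]
    (p₀ : Param d M → ℝ) (X : Ω → Fin d → ℝ) (eps : Ω → Fin M → ℝ) (Y : ℕ → Ω → Resp M)
    (ζ : Policy 𝒳 M) (μ : Measure Ω) : Prop where
  isProbabilityMeasure : IsProbabilityMeasure μ
  prior : μ.map (fun ω => (X ω, eps ω)) = volume.withDensity (fun θ => ENNReal.ofReal (p₀ θ))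
  response : ∀ (n : ℕ) (y : Resp M),
    μ[({ω | Y (n + 1) ω = y}).indicator (fun _ => (1 : ℝ)) |
        MeasurableSpace.comap (fun ω => (X ω, eps ω)) inferInstance ⊔ obs Y n]
      =ᵐ[μ] fun ω => likelihood (ζ n (history Y n ω)).regions y (X ω, eps ω)

end

/-!
By the chain rule for mutual information, the expected entropy loss of a joint query is the entropy
of the predictive law of the responses minus the mean entropy of the channels. For binary symmetric
channels the latter does not depend on the inputs, so the loss is `∑ₘ E[C(εₘ)]` minus the amount by
which the entropy of the responses falls short of its maximum `M`. This shortfall can be made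
arbitrarily small: cut a query region that carries almost all of the mass into thin parallel strips
and ask player `m` for the `m`-th bit of the index of the strip modulo `2^M`. Translations act
continuously on `L¹`, so the residue classes receive nearly equal shares of the joint distribution
of the target and the crossover probabilities, and since
`∑ᵢ gᵢ(y | ε) = 1` the responses become uniform in the limit.

The expectation of `∑ₘ E[C(εₘ) | 𝓕ₙ]` depends neither on `n` nor on the policy, by the tower
property. Hence the mean final entropy is a constant plus the sum of the mean shortfalls, whose
infimum over all policies is zero, and a policy is optimal exactly when all of its shortfalls vanish
almost surely.
-/

open Filter Topology

section Integration

variable {α E : Type*} [MeasurableSpace α] {μ : Measure α}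

theorem integrable_mul_of_abs_le_on_support {f g : α → ℝ} {c : ℝ} (hf : Integrable f μ)
    (hg : AEStronglyMeasurable g μ) (hc : ∀ x, f x ≠ 0 → |g x| ≤ c) :
    Integrable (fun x => g x * f x) μ := by
  refine (hf.norm.const_mul c).mono' (hg.mul hf.aestronglyMeasurable) (ae_of_all _ fun x => ?_)
  by_cases hx : f x = 0
  · simp [hx]
  · rw [norm_mul]
    exact mul_le_mul_of_nonneg_right (hc x hx) (norm_nonneg _)

theorem sum_setIntegral_fiber {ι : Type*} [Fintype ι] [NormedAddCommGroup E] [NormedSpace ℝ E]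
    {g : α → ι} (hg : ∀ i, MeasurableSet (g ⁻¹' {i})) {f : α → E} (hf : Integrable f μ) :
    ∑ i, ∫ x in g ⁻¹' {i}, f x ∂μ = ∫ x, f x ∂μ := by
  rw [← integral_iUnion_fintype hg (pairwise_disjoint_fiber g) fun i => hf.integrableOn,
    ← preimage_iUnion, iUnion_of_singleton, preimage_univ, setIntegral_univ]

theorem setIntegral_mul_condExp {α : Type*} {m m₀ : MeasurableSpace α} {μ : Measure α}
    (hm : m ≤ m₀) [SigmaFinite (μ.trim hm)] {f g : α → ℝ} (hf : StronglyMeasurable[m] f)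
    (hfg : Integrable (f * g) μ) (hg : Integrable g μ) {s : Set α} (hs : MeasurableSet[m] s) :
    ∫ x in s, f x * (μ[g | m]) x ∂μ = ∫ x in s, f x * g x ∂μ :=
  (setIntegral_congr_ae (hm s hs) ((condExp_mul_of_stronglyMeasurable_left hf hfg hg).mono
    fun _ hx _ => hx.symm)).trans (setIntegral_condExp hm hfg hs)

theorem condExp_comap_ae_eq {β : Type*} [MeasurableSpace β] [Finite β] [MeasurableSingletonClass β]
    [IsFiniteMeasure μ] {Z : α → β} (hZ : Measurable Z) {f : α → ℝ} (hf : Integrable f μ)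
    {g : β → ℝ} (h : ∀ b, ∫ x in Z ⁻¹' {b}, f x ∂μ = μ.real (Z ⁻¹' {b}) * g b) :
    μ[f | MeasurableSpace.comap Z inferInstance] =ᵐ[μ] fun x => g (Z x) := by
  cases nonempty_fintype β
  have hgZ : Integrable (fun x => g (Z x)) μ := Integrable.of_finite.comp_measurable hZ
  refine (ae_eq_condExp_of_forall_setIntegral_eq hZ.comap_le hf
    (fun _ _ _ => hgZ.integrableOn) ?_ ?_).symm
  · rintro _ ⟨B, -, rfl⟩ -
    have hZB : ∀ b, MeasurableSet (Z ⁻¹' {b}) := fun b => hZ (measurableSet_singleton b)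
    have hdec : Z ⁻¹' B = ⋃ b ∈ B.toFinite.toFinset, Z ⁻¹' {b} := by ext; simp
    have hdisj : (B.toFinite.toFinset : Set β).PairwiseDisjoint fun b => Z ⁻¹' {b} :=
      fun _ _ _ _ hne => pairwise_disjoint_fiber Z hne
    rw [hdec, integral_biUnion_finset _ (fun b _ => hZB b) hdisj fun _ _ => hgZ.integrableOn,
      integral_biUnion_finset _ (fun b _ => hZB b) hdisj fun _ _ => hf.integrableOn]
    refine Finset.sum_congr rfl fun b _ => ?_
    rw [h, setIntegral_congr_fun (g := fun _ => g b) (hZB b) fun x hx => congrArg g hx,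
      setIntegral_const, smul_eq_mul]
  · exact (measurable_of_finite g).comp (comap_measurable Z)
      |>.stronglyMeasurable.aestronglyMeasurable

end Integration

section Entropy

open Real

theorem negMulLog_prod {ι : Type*} [DecidableEq ι] (s : Finset ι) (f : ι → ℝ) :
    negMulLog (∏ j ∈ s, f j) = ∑ i ∈ s, ∏ j ∈ s, if j = i then negMulLog (f j) else f j := by
  induction s using Finset.induction_on with
  | empty => simp
  | insert a s ha ih =>
    have hnew : ∏ j ∈ s, (if j = a then negMulLog (f j) else f j) = ∏ j ∈ s, f j :=
      Finset.prod_congr rfl fun j hj => if_neg (ne_of_mem_of_not_mem hj ha)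
    have hold : ∀ i ∈ s, ∏ j ∈ insert a s, (if j = i then negMulLog (f j) else f j)
        = f a * ∏ j ∈ s, if j = i then negMulLog (f j) else f j := fun i hi => by
      rw [Finset.prod_insert ha, if_neg (ne_of_mem_of_not_mem hi ha).symm]
    rw [Finset.prod_insert ha, negMulLog_mul, ih, Finset.sum_insert ha, Finset.sum_congr rfl hold,
      Finset.prod_insert ha, if_pos rfl, hnew, ← Finset.mul_sum, mul_comm]

theorem shannonEntropy_eq_sum_negMulLog {α : Type*} [Fintype α] (q : α → ℝ) :
    shannonEntropy q = (∑ a, negMulLog (q a)) / log 2 := by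
  simp only [shannonEntropy, logb, negMulLog, Finset.sum_div, ← Finset.sum_neg_distrib]
  exact Finset.sum_congr rfl fun a _ => by ring

theorem continuous_shannonEntropy {α : Type*} [Fintype α] :
    Continuous (shannonEntropy : (α → ℝ) → ℝ) := by
  simp only [funext shannonEntropy_eq_sum_negMulLog]
  fun_prop

theorem shannonEntropy_pi {ι : Type*} [Fintype ι] [DecidableEq ι] {κ : ι → Type*}
    [∀ i, Fintype (κ i)] {q : ∀ i, κ i → ℝ} (hq : ∀ i, ∑ b, q i b = 1) :
    shannonEntropy (fun a : ∀ i, κ i => ∏ i, q i (a i)) = ∑ i, shannonEntropy (q i) := by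
  have hfactor : ∀ i, ∑ a : ∀ j, κ j, ∏ j, (if j = i then negMulLog (q j (a j)) else q j (a j))
      = ∑ b, negMulLog (q i b) := fun i => by
    rw [← Fintype.piFinset_univ, ← Finset.prod_univ_sum (fun _ => Finset.univ)
      (fun j b => if j = i then negMulLog (q j b) else q j b), Finset.prod_eq_single i]
    · simp only [if_true]
    · intro j _ hj
      simp only [if_neg hj, hq]
    · exact fun hi => absurd (Finset.mem_univ i) hi
  simp only [shannonEntropy_eq_sum_negMulLog, negMulLog_prod, ← Finset.sum_div]
  rw [Finset.sum_comm]
  simp only [hfactor]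

theorem shannonEntropy_le_logb_card {α : Type*} [Fintype α] [Nonempty α] {q : α → ℝ}
    (h0 : ∀ a, 0 ≤ q a) (h1 : ∑ a, q a = 1) : shannonEntropy q ≤ logb 2 (Fintype.card α) := by
  have hK : (0 : ℝ) < Fintype.card α := by exact_mod_cast Fintype.card_pos
  have hJensen := concaveOn_negMulLog.le_map_sum (t := Finset.univ) (p := q)
    (w := fun _ => (Fintype.card α : ℝ)⁻¹) (fun _ _ => by positivity)
    (by simp [hK.ne']) fun a _ => h0 a
  simp only [smul_eq_mul, ← Finset.mul_sum, h1, mul_one] at hJensen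
  rw [negMulLog, log_inv, neg_mul_neg, mul_le_mul_iff_right₀ (inv_pos.2 hK)] at hJensen
  rw [shannonEntropy_eq_sum_negMulLog, logb]
  exact div_le_div_of_nonneg_right hJensen (log_nonneg one_le_two)

theorem shannonEntropy_const_inv_card {α : Type*} [Fintype α] [Nonempty α] :
    shannonEntropy (fun _ : α => (Fintype.card α : ℝ)⁻¹) = logb 2 (Fintype.card α) := by
  simp [shannonEntropy]

theorem diffEntropy_eq_integral_negMulLog {d M : ℕ} (p : Param d M → ℝ) :
    diffEntropy p = (∫ θ, negMulLog (p θ)) / log 2 := by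
  rw [diffEntropy, ← integral_neg, ← integral_div]
  simp only [logb, negMulLog]
  exact integral_congr_ae (ae_of_all _ fun θ => by ring)

end Entropy

section MutualInformation

open Real

theorem mul_negMulLog_div {z : ℝ} (hz : z ≠ 0) (x : ℝ) :
    z * negMulLog (x / z) = negMulLog x + log z * x := by
  rcases eq_or_ne x 0 with rfl | hx
  · simp
  · rw [negMulLog, negMulLog, log_div hx hz]
    field_simp
    ring

theorem abs_negMulLog_le_one {x : ℝ} (h0 : 0 ≤ x) (h1 : x ≤ 1) : |negMulLog x| ≤ 1 := by
  rw [abs_of_nonneg (negMulLog_nonneg h0 h1)]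
  linarith [negMulLog_le_one_sub_self h0]

variable {Θ : Type*} [MeasurableSpace Θ] {μ : Measure Θ} {p L : Θ → ℝ}

theorem integrable_mul_of_mem_Icc_on_support {f : Θ → ℝ} (hf : Integrable f μ)
    (hL : Measurable L) (hL01 : ∀ θ, f θ ≠ 0 → L θ ∈ Icc (0 : ℝ) 1) :
    Integrable (fun θ => L θ * f θ) μ :=
  integrable_mul_of_abs_le_on_support (c := 1) hf hL.aestronglyMeasurable fun θ hθ =>
    abs_le.2 ⟨by linarith [(hL01 θ hθ).1], (hL01 θ hθ).2⟩

theorem integrable_negMulLog_comp_mul (hp : Integrable p μ) (hL : Measurable L)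
    (hL01 : ∀ θ, p θ ≠ 0 → L θ ∈ Icc (0 : ℝ) 1) :
    Integrable (fun θ => negMulLog (L θ) * p θ) μ :=
  integrable_mul_of_abs_le_on_support hp
    (continuous_negMulLog.measurable.comp hL).aestronglyMeasurable fun θ hθ =>
      abs_negMulLog_le_one (hL01 θ hθ).1 (hL01 θ hθ).2

theorem integrable_mul_negMulLog_comp (hH : Integrable (fun θ => negMulLog (p θ)) μ)
    (hL : Measurable L) (hL01 : ∀ θ, p θ ≠ 0 → L θ ∈ Icc (0 : ℝ) 1) :
    Integrable (fun θ => L θ * negMulLog (p θ)) μ :=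
  integrable_mul_of_mem_Icc_on_support hH hL fun θ hθ => hL01 θ fun h => hθ (by simp [h])

theorem integrable_negMulLog_mul (hp : Integrable p μ)
    (hH : Integrable (fun θ => negMulLog (p θ)) μ) (hL : Measurable L)
    (hL01 : ∀ θ, p θ ≠ 0 → L θ ∈ Icc (0 : ℝ) 1) :
    Integrable (fun θ => negMulLog (L θ * p θ)) μ := by
  simp only [negMulLog_mul, mul_comm (p _)]
  exact (integrable_negMulLog_comp_mul hp hL hL01).add
    (integrable_mul_negMulLog_comp hH hL hL01)

theorem integrable_negMulLog_mul_div (hp : Integrable p μ)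
    (hH : Integrable (fun θ => negMulLog (p θ)) μ) (hL : Measurable L)
    (hL01 : ∀ θ, p θ ≠ 0 → L θ ∈ Icc (0 : ℝ) 1) {z : ℝ} (hz : z ≠ 0) :
    Integrable (fun θ => negMulLog (L θ * p θ / z)) μ := by
  refine ((((integrable_negMulLog_mul hp hH hL hL01).add
    ((integrable_mul_of_mem_Icc_on_support hp hL hL01).const_mul (log z))).const_mul z⁻¹).congr
      (ae_of_all _ fun θ => ?_))
  simp only [Pi.add_apply]
  rw [← mul_negMulLog_div hz, inv_mul_cancel_left₀ hz]

theorem mul_integral_negMulLog_mul_div (hp : Integrable p μ)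
    (hH : Integrable (fun θ => negMulLog (p θ)) μ) (hL : Measurable L)
    (hL01 : ∀ θ, p θ ≠ 0 → L θ ∈ Icc (0 : ℝ) 1) (hz : ∫ θ, L θ * p θ ∂μ ≠ 0) :
    (∫ θ, L θ * p θ ∂μ) * ∫ θ, negMulLog (L θ * p θ / ∫ θ, L θ * p θ ∂μ) ∂μ
      = ∫ θ, negMulLog (L θ) * p θ ∂μ + ∫ θ, L θ * negMulLog (p θ) ∂μ
        - negMulLog (∫ θ, L θ * p θ ∂μ) := by
  have hevidence : negMulLog (∫ θ, L θ * p θ ∂μ)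
      = -(log (∫ θ, L θ * p θ ∂μ) * ∫ θ, L θ * p θ ∂μ) := by rw [negMulLog]; ring
  rw [← integral_const_mul]
  simp only [mul_negMulLog_div hz]
  rw [integral_add (integrable_negMulLog_mul hp hH hL hL01)
    ((integrable_mul_of_mem_Icc_on_support hp hL hL01).const_mul _), integral_const_mul]
  simp only [negMulLog_mul, mul_comm (p _)]
  rw [integral_add (integrable_negMulLog_comp_mul hp hL hL01)
    (integrable_mul_negMulLog_comp hH hL hL01), hevidence, sub_neg_eq_add]

theorem integral_negMulLog_sub_sum_posterior {ι : Type*} [Fintype ι] {L : ι → Θ → ℝ}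
    (hp : Integrable p μ) (hH : Integrable (fun θ => negMulLog (p θ)) μ)
    (hL : ∀ y, Measurable (L y)) (hL01 : ∀ y θ, p θ ≠ 0 → L y θ ∈ Icc (0 : ℝ) 1)
    (hsum : ∀ θ, ∑ y, L y θ = 1) (hz : ∀ y, ∫ θ, L y θ * p θ ∂μ ≠ 0) :
    ∫ θ, negMulLog (p θ) ∂μ - ∑ y, (∫ θ, L y θ * p θ ∂μ) *
        ∫ θ, negMulLog (L y θ * p θ / ∫ θ, L y θ * p θ ∂μ) ∂μ
      = ∑ y, negMulLog (∫ θ, L y θ * p θ ∂μ) - ∫ θ, (∑ y, negMulLog (L y θ)) * p θ ∂μ := by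
  have hprior : ∑ y, ∫ θ, L y θ * negMulLog (p θ) ∂μ = ∫ θ, negMulLog (p θ) ∂μ := by
    rw [← integral_finsetSum _ fun y _ => integrable_mul_negMulLog_comp hH (hL y) (hL01 y)]
    simp only [← Finset.sum_mul, hsum, one_mul]
  have hnoise : ∑ y, ∫ θ, negMulLog (L y θ) * p θ ∂μ
      = ∫ θ, (∑ y, negMulLog (L y θ)) * p θ ∂μ := by
    rw [← integral_finsetSum _ fun y _ => integrable_negMulLog_comp_mul hp (hL y) (hL01 y)]
    simp only [Finset.sum_mul]
  rw [Finset.sum_congr rfl fun y _ =>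
      mul_integral_negMulLog_mul_div hp hH (hL y) (hL01 y) (hz y),
    Finset.sum_sub_distrib, Finset.sum_add_distrib, hprior, hnoise]
  ring

end MutualInformation

/-! ### Binary symmetric channels -/

section Channel

variable {M : ℕ} {e : Fin M → ℝ}

theorem bsc_pos {e : ℝ} (he : e ∈ Ioo (0 : ℝ) (1 / 2)) (j y : Bool) : 0 < bsc e j y := by
  unfold bsc
  split_ifs
  · linarith [he.2]
  · exact he.1

theorem sum_bsc (e : ℝ) (j : Bool) : ∑ y, bsc e j y = 1 := by
  cases j <;> simp [bsc]

theorem shannonEntropy_bsc (e : ℝ) (j : Bool) : shannonEntropy (bsc e j) = 1 - bscCapacity e := by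
  cases j <;>
    simp only [shannonEntropy, bsc, bscCapacity, Fintype.sum_bool, if_true, reduceCtorEq,
      if_false] <;> ring

theorem bscProd_pos (he : e ∈ epsBox M) (i y : Resp M) : 0 < bscProd e i y :=
  Finset.prod_pos fun m _ => bsc_pos (he m) _ _

theorem sum_bscProd (e : Fin M → ℝ) (i : Resp M) : ∑ y, bscProd e i y = 1 := by
  have h := Finset.prod_univ_sum (fun _ : Fin M => (Finset.univ : Finset Bool))
    (fun m b => bsc (e m) (i m) b)
  simp only [sum_bsc, Finset.prod_const_one, Fintype.piFinset_univ] at h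
  exact h.symm

theorem bscProd_le_one (he : e ∈ epsBox M) (i y : Resp M) : bscProd e i y ≤ 1 := by
  rw [← sum_bscProd e i]
  exact Finset.single_le_sum (f := bscProd e i) (fun y _ => (bscProd_pos he i y).le)
    (Finset.mem_univ y)

theorem bscProd_comm (e : Fin M → ℝ) (i y : Resp M) : bscProd e i y = bscProd e y i := by
  simp only [bscProd, bsc, eq_comm]

theorem shannonEntropy_bscProd (e : Fin M → ℝ) (i : Resp M) :
    shannonEntropy (bscProd e i) = M - ∑ m, bscCapacity (e m) := by
  have h := shannonEntropy_pi fun m => sum_bsc (e m) (i m)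
  simp only [shannonEntropy_bsc, Finset.sum_sub_distrib, Finset.sum_const, Finset.card_univ,
    Fintype.card_fin, nsmul_eq_mul, mul_one] at h
  exact h

theorem measurable_bscProd (i y : Resp M) : Measurable fun e : Fin M → ℝ => bscProd e i y := by
  refine Finset.measurable_prod _ fun m _ => ?_
  unfold bsc
  split_ifs <;> fun_prop

theorem bscCapacity_eq (e : ℝ) : bscCapacity e = 1 - Real.binEntropy e / Real.log 2 := by
  simp only [bscCapacity, Real.logb, Real.binEntropy_eq_negMulLog_add_negMulLog_one_sub,
    Real.negMulLog]
  ring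

theorem continuous_bscCapacity : Continuous bscCapacity := by
  simp only [funext bscCapacity_eq]
  fun_prop

theorem abs_bscCapacity_le_one {e : ℝ} (h0 : 0 ≤ e) (h1 : e ≤ 1) : |bscCapacity e| ≤ 1 := by
  have hlog : 0 < Real.log 2 := Real.log_pos one_lt_two
  have hnonneg : 0 ≤ Real.binEntropy e / Real.log 2 :=
    div_nonneg (Real.binEntropy_nonneg h0 h1) hlog.le
  have hle : Real.binEntropy e / Real.log 2 ≤ 1 := (div_le_one hlog).2 Real.binEntropy_le_log_two
  rw [bscCapacity_eq, abs_le]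
  constructor <;> linarith

theorem logb_card_resp (M : ℕ) : Real.logb 2 (Fintype.card (Resp M)) = M := by
  simp [Real.logb_pow]

end Channel

/-! ### Bayes' rule and the expected entropy loss -/

section Answers

variable {d M : ℕ} {A : Fin M → Set (Fin d → ℝ)}

theorem cell_eq_preimage_answers (A : Fin M → Set (Fin d → ℝ)) (i : Resp M) :
    cell A i = answers A ⁻¹' {i} := by
  ext x
  simp only [cell, mem_iInter, mem_preimage, mem_singleton_iff, answers, funext_iff]
  refine forall_congr' fun m => ?_
  by_cases hx : x ∈ A m <;> cases h : i m <;> simp [hx]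

theorem measurable_answers (hA : ∀ m, MeasurableSet (A m)) : Measurable (answers A) :=
  measurable_pi_iff.2 fun m => measurable_to_bool <| by
    convert hA m using 1
    ext x
    simp [answers]

theorem measurable_likelihood (hA : ∀ m, MeasurableSet (A m)) (y : Resp M) :
    Measurable (likelihood A y) :=
  (measurable_from_prod_countable_right (f := fun z : Resp M × (Fin M → ℝ) => bscProd z.2 z.1 y)
    fun i => measurable_bscProd i y).comp
      (((measurable_answers hA).comp measurable_fst).prodMk measurable_snd)

theorem sum_likelihood (A : Fin M → Set (Fin d → ℝ)) (θ : Param d M) :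
    ∑ y, likelihood A y θ = 1 :=
  sum_bscProd _ _

theorem integral_mul_regionDensity {p : Param d M → ℝ} {G : (Fin M → ℝ) → ℝ}
    {R : Set (Fin d → ℝ)} (hG : IntegrableOn (fun θ : Param d M => G θ.2 * p θ) (R ×ˢ univ)) :
    ∫ e, G e * regionDensity p R e = ∫ θ in R ×ˢ univ, G θ.2 * p θ := by
  rw [IntegrableOn, Measure.volume_eq_prod, ← Measure.prod_restrict, Measure.restrict_univ] at hG
  rw [Measure.volume_eq_prod, ← Measure.prod_restrict, Measure.restrict_univ,
    integral_prod_symm _ hG]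
  simp only [regionDensity, integral_const_mul]

end Answers

/-- The mean of the total capacity `∑ₘ C(εₘ)` of the channels when `(X*, ε*)` has density `p`; it
turns out to be the maximal gain. -/
noncomputable def meanCapacity {d M : ℕ} (p : Param d M → ℝ) : ℝ :=
  ∫ θ, (∑ m, bscCapacity (θ.2 m)) * p θ

namespace IsPriorDensity

variable {d M : ℕ} {𝒳 : Set (Fin d → ℝ)} {p : Param d M → ℝ} {A : Fin M → Set (Fin d → ℝ)}

theorem integrable (hp : IsPriorDensity 𝒳 p) : Integrable p :=
  integrable_of_integral_eq_one hp.integral_eq_one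

theorem mem_of_ne_zero (hp : IsPriorDensity 𝒳 p) {θ : Param d M} (h : p θ ≠ 0) :
    θ ∈ 𝒳 ×ˢ epsBox M :=
  not_imp_comm.1 (hp.eq_zero θ) h

theorem likelihood_pos (hp : IsPriorDensity 𝒳 p) (A : Fin M → Set (Fin d → ℝ)) (y : Resp M)
    {θ : Param d M} (h : p θ ≠ 0) : 0 < likelihood A y θ :=
  bscProd_pos (hp.mem_of_ne_zero h).2 _ _

theorem likelihood_mem_Icc (hp : IsPriorDensity 𝒳 p) (A : Fin M → Set (Fin d → ℝ)) (y : Resp M)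
    (θ : Param d M) (h : p θ ≠ 0) : likelihood A y θ ∈ Icc (0 : ℝ) 1 :=
  ⟨(hp.likelihood_pos A y h).le, bscProd_le_one (hp.mem_of_ne_zero h).2 _ _⟩

theorem likelihood_mul_nonneg (hp : IsPriorDensity 𝒳 p) (A : Fin M → Set (Fin d → ℝ)) (y : Resp M)
    (θ : Param d M) : 0 ≤ likelihood A y θ * p θ := by
  by_cases h : p θ = 0
  · simp [h]
  · exact mul_nonneg (hp.likelihood_pos A y h).le (hp.nonneg θ)

theorem integrable_likelihood_mul (hp : IsPriorDensity 𝒳 p) (hA : ∀ m, MeasurableSet (A m))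
    (y : Resp M) : Integrable fun θ => likelihood A y θ * p θ :=
  integrable_mul_of_mem_Icc_on_support hp.integrable (measurable_likelihood hA y)
    (hp.likelihood_mem_Icc A y)

theorem predictive_pos (hp : IsPriorDensity 𝒳 p) (hA : ∀ m, MeasurableSet (A m)) (y : Resp M) :
    0 < predictive p A y := by
  refine (integral_nonneg (hp.likelihood_mul_nonneg A y)).lt_of_ne' fun h => ?_
  have hzero := (integral_eq_zero_iff_of_nonneg (hp.likelihood_mul_nonneg A y)
    (hp.integrable_likelihood_mul hA y)).1 h
  have hp0 : p =ᵐ[volume] 0 := by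
    filter_upwards [hzero] with θ hθ
    by_contra hne
    exact mul_ne_zero (hp.likelihood_pos A y hne).ne' hne hθ
  have hintegral : ∫ θ, p θ = 0 := (integral_congr_ae hp0).trans (integral_zero' _ _)
  exact zero_ne_one (hintegral.symm.trans hp.integral_eq_one)

theorem sum_predictive (hp : IsPriorDensity 𝒳 p) (hA : ∀ m, MeasurableSet (A m)) :
    ∑ y, predictive p A y = 1 := by
  unfold predictive
  rw [← integral_finsetSum _ fun y _ => hp.integrable_likelihood_mul hA y]
  simp only [← Finset.sum_mul, sum_likelihood, one_mul]
  exact hp.integral_eq_one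

theorem integrable_negMulLog (hp : IsPriorDensity 𝒳 p) :
    Integrable fun θ => Real.negMulLog (p θ) := by
  refine (hp.entropy_finite.const_mul (-Real.log 2)).congr (ae_of_all _ fun θ => ?_)
  have hlog : Real.log 2 ≠ 0 := (Real.log_pos one_lt_two).ne'
  simp only [Real.negMulLog, Real.logb]
  field_simp

protected theorem bayesUpdate (hp : IsPriorDensity 𝒳 p) (hA : ∀ m, MeasurableSet (A m))
    (y : Resp M) : IsPriorDensity 𝒳 (bayesUpdate p A y) where
  measurable := ((measurable_likelihood hA y).mul hp.measurable).div_const _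
  nonneg θ := div_nonneg (hp.likelihood_mul_nonneg A y θ) (hp.predictive_pos hA y).le
  eq_zero θ hθ := by simp [bayesUpdate, hp.eq_zero θ hθ]
  integral_eq_one := by
    unfold bayesUpdate
    rw [integral_div]
    exact div_self (hp.predictive_pos hA y).ne'
  entropy_finite := by
    have h := integrable_negMulLog_mul_div hp.integrable hp.integrable_negMulLog
      (measurable_likelihood hA y) (hp.likelihood_mem_Icc A y) (hp.predictive_pos hA y).ne'
    refine (h.neg.div_const (Real.log 2)).congr (ae_of_all _ fun θ => ?_)
    simp only [Pi.neg_apply, Real.negMulLog, Real.logb, bayesUpdate]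
    ring

theorem entropyLoss_eq_shannonEntropy_sub (hp : IsPriorDensity 𝒳 p)
    (hA : ∀ m, MeasurableSet (A m)) :
    entropyLoss p A = shannonEntropy (predictive p A)
      - ∫ θ, shannonEntropy (bscProd θ.2 (answers A θ.1)) * p θ := by
  have h := integral_negMulLog_sub_sum_posterior hp.integrable hp.integrable_negMulLog
    (measurable_likelihood hA) (hp.likelihood_mem_Icc A) (sum_likelihood A)
    fun y => (hp.predictive_pos hA y).ne'
  simp only [entropyLoss, diffEntropy_eq_integral_negMulLog, shannonEntropy_eq_sum_negMulLog,
    mul_div_assoc', ← Finset.sum_div, div_mul_eq_mul_div, integral_div, ← sub_div]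
  exact congrArg (· / Real.log 2) h

theorem sum_integral_mul_regionDensity_cell (hp : IsPriorDensity 𝒳 p)
    (hA : ∀ m, MeasurableSet (A m)) {F : Resp M → (Fin M → ℝ) → ℝ}
    (hF : Integrable fun θ => F (answers A θ.1) θ.2 * p θ) :
    ∑ i, ∫ e in epsBox M, F i e * regionDensity p (cell A i) e
      = ∫ θ, F (answers A θ.1) θ.2 * p θ := by
  have hfiber : ∀ i, MeasurableSet ((fun θ : Param d M => answers A θ.1) ⁻¹' {i}) := fun i =>
    (measurable_answers hA).comp measurable_fst (measurableSet_singleton i)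
  rw [← sum_setIntegral_fiber hfiber hF]
  refine Finset.sum_congr rfl fun i _ => ?_
  have hcell : cell A i ×ˢ univ = (fun θ : Param d M => answers A θ.1) ⁻¹' {i} := by
    rw [cell_eq_preimage_answers, prod_univ]
    rfl
  have hFi : EqOn (fun θ : Param d M => F i θ.2 * p θ) (fun θ => F (answers A θ.1) θ.2 * p θ)
      ((fun θ : Param d M => answers A θ.1) ⁻¹' {i}) := fun θ hθ => by
    rw [← show answers A θ.1 = i from hθ]
  have hbox : ∀ e ∉ epsBox M, F i e * regionDensity p (cell A i) e = 0 := fun e he => by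
    simp [regionDensity, fun x => hp.eq_zero (x, e) fun h => he h.2]
  rw [setIntegral_eq_integral_of_forall_compl_eq_zero hbox, integral_mul_regionDensity, hcell,
    setIntegral_congr_fun (hfiber i) hFi]
  rw [hcell]
  exact hF.integrableOn.congr_fun hFi.symm (hfiber i)

theorem integrable_capacity_mul (hp : IsPriorDensity 𝒳 p) (m : Fin M) :
    Integrable fun θ => bscCapacity (θ.2 m) * p θ :=
  integrable_mul_of_abs_le_on_support hp.integrable
    (continuous_bscCapacity.comp ((continuous_apply m).comp continuous_snd)).aestronglyMeasurable
    fun θ hθ => by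
      obtain ⟨hpos, hlt⟩ := (hp.mem_of_ne_zero hθ).2 m
      exact abs_bscCapacity_le_one hpos.le (by linarith)

theorem meanCapacity_eq_sum (hp : IsPriorDensity 𝒳 p) :
    meanCapacity p = ∑ m, ∫ θ, bscCapacity (θ.2 m) * p θ := by
  unfold meanCapacity
  rw [← integral_finsetSum _ fun m _ => hp.integrable_capacity_mul m]
  simp only [Finset.sum_mul]

theorem integrable_sum_capacity_mul (hp : IsPriorDensity 𝒳 p) :
    Integrable fun θ : Param d M => (∑ m, bscCapacity (θ.2 m)) * p θ := by
  simp only [Finset.sum_mul]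
  exact integrable_finsetSum _ fun m _ => hp.integrable_capacity_mul m

theorem integrable_shannonEntropy_mul (hp : IsPriorDensity 𝒳 p) (A : Fin M → Set (Fin d → ℝ)) :
    Integrable fun θ => shannonEntropy (bscProd θ.2 (answers A θ.1)) * p θ := by
  simp only [shannonEntropy_bscProd, sub_mul]
  exact (hp.integrable.const_mul _).sub hp.integrable_sum_capacity_mul

theorem integral_shannonEntropy_mul (hp : IsPriorDensity 𝒳 p) (A : Fin M → Set (Fin d → ℝ)) :
    ∫ θ, shannonEntropy (bscProd θ.2 (answers A θ.1)) * p θ = M - meanCapacity p := by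
  simp only [shannonEntropy_bscProd, sub_mul]
  rw [integral_sub (hp.integrable.const_mul _) hp.integrable_sum_capacity_mul, integral_const_mul,
    hp.integral_eq_one, mul_one]
  rfl

theorem entropyLoss_eq_mixtureGain (hp : IsPriorDensity 𝒳 p) (hA : ∀ m, MeasurableSet (A m)) :
    entropyLoss p A = mixtureGain p A := by
  have hpredictive : ∀ y, ∑ i, ∫ e in epsBox M, bscProd e i y * regionDensity p (cell A i) e
      = predictive p A y := fun y =>
    hp.sum_integral_mul_regionDensity_cell hA (F := fun i e => bscProd e i y)
      (hp.integrable_likelihood_mul hA y)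
  rw [hp.entropyLoss_eq_shannonEntropy_sub hA, mixtureGain,
    hp.sum_integral_mul_regionDensity_cell hA (F := fun i e => shannonEntropy (bscProd e i))
      (hp.integrable_shannonEntropy_mul A)]
  simp only [hpredictive]

theorem entropyLoss_eq_add_meanCapacity (hp : IsPriorDensity 𝒳 p) (hA : ∀ m, MeasurableSet (A m)) :
    entropyLoss p A = shannonEntropy (predictive p A) - M + meanCapacity p := by
  rw [hp.entropyLoss_eq_shannonEntropy_sub hA, hp.integral_shannonEntropy_mul]
  ring

theorem entropyLoss_le_meanCapacity (hp : IsPriorDensity 𝒳 p) (hA : ∀ m, MeasurableSet (A m)) :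
    entropyLoss p A ≤ meanCapacity p := by
  have h := shannonEntropy_le_logb_card (fun y => (hp.predictive_pos hA y).le)
    (hp.sum_predictive hA)
  rw [hp.entropyLoss_eq_add_meanCapacity hA]
  linarith [logb_card_resp M]

end IsPriorDensity

/-! ### Equidistribution of fine strips -/

section Equidistribution

variable {E : Type*} [NormedAddCommGroup E]

theorem tendsto_integral_norm_vadd_sub {G α : Type*} [AddMonoid G] [TopologicalSpace G]
    [MeasurableSpace G] [OpensMeasurableSpace G] [TopologicalSpace α] [R1Space α]
    [MeasurableSpace α] [BorelSpace α] [AddAction G α] [ContinuousVAdd G α] {μ : Measure α}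
    [IsLocallyFiniteMeasure μ] [μ.InnerRegularCompactLTTop] [VAddInvariantMeasure G α μ]
    {φ : α → E} (hφ : Integrable φ μ) :
    Tendsto (fun g : G => ∫ x, ‖φ (g +ᵥ x) - φ x‖ ∂μ) (𝓝 0) (𝓝 0) := by
  have : Fact ((1 : ENNReal) ≠ ⊤) := ⟨ENNReal.one_ne_top⟩
  have hmem : MemLp φ 1 μ := memLp_one_iff_integrable.2 hφ
  have hnorm : ∀ g : G, ‖(DomAddAct.mk g +ᵥ hmem.toLp φ) - hmem.toLp φ‖
      = ∫ x, ‖φ (g +ᵥ x) - φ x‖ ∂μ := fun g => by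
    have hg := (hmem.comp_measurePreserving (measurePreserving_vadd g μ)).coeFn_toLp
    rw [DomAddAct.mk_vadd_toLp, L1.norm_eq_integral_norm]
    refine integral_congr_ae ?_
    filter_upwards [Lp.coeFn_sub (DomAddAct.mk g +ᵥ hmem.toLp φ) (hmem.toLp φ), hg,
      hmem.coeFn_toLp] with x hsub hx hx'
    exact congrArg norm (hsub.trans (congrArg₂ (· - ·) hx hx'))
  have hcont : Continuous fun g : G => ‖(DomAddAct.mk g +ᵥ hmem.toLp φ) - hmem.toLp φ‖ :=
    ((DomAddAct.continuous_mk.vadd continuous_const).sub continuous_const).norm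
  have hzero : ‖(DomAddAct.mk (0 : G) +ᵥ hmem.toLp φ) - hmem.toLp φ‖ = 0 := by
    rw [hnorm]
    simp
  have h := hcont.tendsto 0
  rw [hzero] at h
  exact h.congr hnorm

/-- The residue modulo `q` of the index `j` of the strip `j δ ≤ x_l < (j + 1) δ` containing `x`;
its fibers are the interleaved families of strips that are used as queries. -/
noncomputable def stripIndex {ι : Type*} (l : ι) (q : ℕ) (δ : ℝ) (x : ι → ℝ) : ZMod q :=
  (⌊x l / δ⌋ : ℤ)

variable {ι : Type*} {q : ℕ}

theorem measurableSet_stripIndex_fiber (l : ι) (δ : ℝ) (c : ZMod q) :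
    MeasurableSet (stripIndex l q δ ⁻¹' {c}) :=
  have hfloor : Measurable fun x : ι → ℝ => ⌊x l / δ⌋ :=
    Int.measurable_floor.comp (by fun_prop)
  hfloor (MeasurableSet.of_discrete (s := {j : ℤ | (j : ZMod q) = c}))

theorem stripIndex_single_add [DecidableEq ι] (l : ι) {δ : ℝ} (hδ : δ ≠ 0) (j : ℤ) (x : ι → ℝ) :
    stripIndex l q δ (Pi.single l (j * δ) + x) = stripIndex l q δ x + j := by
  rw [stripIndex, Pi.add_apply, Pi.single_eq_same, add_div, mul_div_cancel_right₀ _ hδ,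
    Int.floor_intCast_add, Int.cast_add, add_comm, stripIndex]

variable [Fintype ι] [NormedSpace ℝ E]

theorem tendsto_setIntegral_stripIndex_sub (l : ι) {φ : (ι → ℝ) → E} (hφ : Integrable φ)
    (c c' : ZMod q) :
    Tendsto (fun δ : ℝ => (∫ x in stripIndex l q δ ⁻¹' {c'}, φ x)
      - ∫ x in stripIndex l q δ ⁻¹' {c}, φ x) (𝓝[>] 0) (𝓝 0) := by
  classical
  -- Translating by `j δ` along the axis carries one class onto the other, and translations act
  -- continuously on `L¹`.
  obtain ⟨j, hj⟩ := ZMod.intCast_surjective (c' - c)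
  have hshift : Tendsto (fun δ : ℝ => (Pi.single l (j * δ) : ι → ℝ)) (𝓝[>] 0) (𝓝 0) := by
    have hcont : Continuous fun δ : ℝ => (Pi.single l (j * δ) : ι → ℝ) :=
      (continuous_single l).comp (continuous_const.mul continuous_id)
    simpa using (hcont.tendsto 0).mono_left nhdsWithin_le_nhds
  refine squeeze_zero_norm' ?_ ((tendsto_integral_norm_vadd_sub hφ).comp hshift)
  filter_upwards [self_mem_nhdsWithin] with δ hδ
  set v : ι → ℝ := Pi.single l (j * δ)
  have hfiber : (v + ·) ⁻¹' (stripIndex l q δ ⁻¹' {c'}) = stripIndex l q δ ⁻¹' {c} := by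
    ext x
    simp only [mem_preimage, mem_singleton_iff, v, stripIndex_single_add l (ne_of_gt hδ), hj]
    rw [← eq_sub_iff_add_eq, sub_sub_cancel]
  have hφv : Integrable fun x => φ (v + x) := hφ.comp_add_left v
  rw [← (measurePreserving_add_left volume v).setIntegral_preimage_emb
      (measurableEmbedding_addLeft v), hfiber, ← integral_sub hφv.integrableOn hφ.integrableOn]
  exact (norm_integral_le_integral_norm _).trans
    (setIntegral_le_integral (hφv.sub hφ).norm (ae_of_all _ fun x => norm_nonneg _))

theorem tendsto_setIntegral_stripIndex [NeZero q] (l : ι) {φ : (ι → ℝ) → E} (hφ : Integrable φ)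
    (c : ZMod q) :
    Tendsto (fun δ : ℝ => ∫ x in stripIndex l q δ ⁻¹' {c}, φ x) (𝓝[>] 0)
      (𝓝 ((q : ℝ)⁻¹ • ∫ x, φ x)) := by
  have hq : (q : ℝ) ≠ 0 := NeZero.ne _
  have hlim := tendsto_finsetSum (Finset.univ : Finset (ZMod q)) fun c' _ =>
    tendsto_setIntegral_stripIndex_sub l hφ c c'
  simp only [Finset.sum_sub_distrib, Finset.sum_const, Finset.card_univ, ZMod.card, smul_zero,
    sum_setIntegral_fiber (measurableSet_stripIndex_fiber l _) hφ, ← Nat.cast_smul_eq_nsmul ℝ]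
    at hlim
  have h := ((tendsto_const_nhds (x := ∫ x, φ x)).sub hlim).const_smul (q : ℝ)⁻¹
  simpa only [sub_sub_cancel, sub_zero, inv_smul_smul₀ hq] using h

end Equidistribution

/-! ### Query regions -/

theorem measurableSet_rect {d : ℕ} (a b : Fin d → ℝ) : MeasurableSet (rect a b) := by
  simp only [rect, ofPred_forall]
  exact MeasurableSet.iInter fun l => measurable_pi_apply l measurableSet_Ico

theorem rect_inter_Ico {d : ℕ} (a b : Fin d → ℝ) (l : Fin d) (u v : ℝ) :
    rect a b ∩ {x | x l ∈ Ico u v}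
      = rect (Function.update a l (max (a l) u)) (Function.update b l (min (b l) v)) := by
  ext x
  simp only [rect, mem_inter_iff, mem_ofPred_eq, mem_Ico]
  constructor
  · rintro ⟨hx, hu, hv⟩ k
    rcases eq_or_ne k l with rfl | hk
    · simpa using ⟨⟨(hx k).1, hu⟩, (hx k).2, hv⟩
    · simpa [hk] using hx k
  · intro hx
    have hl := hx l
    simp only [Function.update_self, max_le_iff, lt_min_iff] at hl
    refine ⟨fun k => ?_, hl.1.2, hl.2.2⟩
    rcases eq_or_ne k l with rfl | hk
    · exact ⟨hl.1.1, hl.2.1⟩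
    · simpa [hk] using hx k

theorem exists_rat_rect {d : ℕ} {U : Set (Fin d → ℝ)} (hU : IsOpen U) {x : Fin d → ℝ}
    (hx : x ∈ U) :
    ∃ a b : Fin d → ℚ, x ∈ rect (fun l => (a l : ℝ)) (fun l => (b l : ℝ)) ∧
      rect (fun l => (a l : ℝ)) (fun l => (b l : ℝ)) ⊆ U := by
  obtain ⟨r, hr, hball⟩ := Metric.isOpen_iff.1 hU x hx
  choose a ha hax using fun l => exists_rat_btwn (show x l - r < x l by linarith)
  choose b hxb hb using fun l => exists_rat_btwn (show x l < x l + r by linarith)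
  refine ⟨a, b, fun l => ⟨(hax l).le, hxb l⟩, fun z hz => hball ?_⟩
  rw [Metric.mem_ball, dist_pi_lt_iff hr]
  intro l
  rw [Real.dist_eq, abs_lt]
  constructor <;> linarith [(hz l).1, (hz l).2, ha l, hb l]

namespace IsQueryRegion

variable {d : ℕ} {𝒳 A : Set (Fin d → ℝ)}

theorem measurableSet (h : IsQueryRegion 𝒳 A) : MeasurableSet A := by
  obtain ⟨J, a, b, -, -, rfl⟩ := h
  exact MeasurableSet.iUnion fun j => measurableSet_rect _ _

theorem empty : IsQueryRegion 𝒳 ∅ :=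
  ⟨0, Fin.elim0, Fin.elim0, fun j => j.elim0, fun j => j.elim0, by simp⟩

theorem of_finite {ι : Type*} [Finite ι] (a b : ι → Fin d → ℝ) (hab : ∀ i l, a i l ≤ b i l)
    (h : ∀ i, rect (a i) (b i) ⊆ 𝒳) : IsQueryRegion 𝒳 (⋃ i, rect (a i) (b i)) := by
  obtain ⟨n, ⟨f⟩⟩ := Finite.exists_equiv_fin ι
  exact ⟨n, a ∘ f.symm, b ∘ f.symm, fun j => hab _, fun j => h _,
    (f.symm.surjective.iUnion_comp fun i => rect (a i) (b i)).symm⟩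

theorem iUnion {ι : Type*} [Finite ι] {A : ι → Set (Fin d → ℝ)}
    (h : ∀ i, IsQueryRegion 𝒳 (A i)) : IsQueryRegion 𝒳 (⋃ i, A i) := by
  choose J a b hab hsub hA using h
  have hunion : ⋃ i, A i = ⋃ k : Σ i, Fin (J i), rect (a k.1 k.2) (b k.1 k.2) := by
    rw [iUnion_sigma]
    exact iUnion_congr hA
  rw [hunion]
  exact of_finite _ _ (fun k => hab k.1 k.2) fun k => hsub k.1 k.2

theorem of_rect {a b : Fin d → ℝ} (h : rect a b ⊆ 𝒳) : IsQueryRegion 𝒳 (rect a b) := by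
  by_cases hab : ∀ l, a l ≤ b l
  · simpa only [iUnion_const] using
      of_finite (fun _ : Unit => a) (fun _ => b) (fun _ => hab) fun _ => h
  · have hempty : rect a b = ∅ :=
      eq_empty_of_forall_notMem fun x hx => hab fun l => (hx l).1.trans (hx l).2.le
    rw [hempty]
    exact empty

theorem inter_Ico (h : IsQueryRegion 𝒳 A) (l : Fin d) (u v : ℝ) :
    IsQueryRegion 𝒳 (A ∩ {x | x l ∈ Ico u v}) := by
  obtain ⟨J, a, b, -, hsub, rfl⟩ := h
  rw [iUnion_inter]
  refine iUnion fun j => ?_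
  have hj : rect (a j) (b j) ∩ {x | x l ∈ Ico u v} ⊆ 𝒳 := inter_subset_left.trans (hsub j)
  rw [rect_inter_Ico] at hj ⊢
  exact of_rect hj

theorem finite_image_floor (h : IsQueryRegion 𝒳 A) (l : Fin d) {δ : ℝ} (hδ : 0 < δ) :
    ((fun x : Fin d → ℝ => ⌊x l / δ⌋) '' A).Finite := by
  obtain ⟨J, a, b, -, -, rfl⟩ := h
  rw [image_iUnion]
  refine finite_iUnion fun j => (finite_Icc ⌊a j l / δ⌋ ⌊b j l / δ⌋).subset ?_
  rintro _ ⟨x, hx, rfl⟩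
  obtain ⟨hax, hxb⟩ := hx l
  exact ⟨Int.floor_le_floor (by gcongr), Int.floor_le_floor (by gcongr)⟩

theorem inter_stripIndex_fiber (h : IsQueryRegion 𝒳 A) (l : Fin d) {q : ℕ} {δ : ℝ} (hδ : 0 < δ)
    (c : ZMod q) : IsQueryRegion 𝒳 (A ∩ stripIndex l q δ ⁻¹' {c}) := by
  let J : Set ℤ := {j ∈ (fun x : Fin d → ℝ => ⌊x l / δ⌋) '' A | (j : ZMod q) = c}
  have : Finite J := ((h.finite_image_floor l hδ).subset (sep_subset _ _)).to_subtype
  have hfloor : ∀ (x : Fin d → ℝ) (j : ℤ), x l ∈ Ico (j * δ) ((j + 1) * δ) ↔ ⌊x l / δ⌋ = j :=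
    fun x j => by rw [Int.floor_eq_iff, mem_Ico, le_div_iff₀ hδ, div_lt_iff₀ hδ]
  have hunion : A ∩ stripIndex l q δ ⁻¹' {c}
      = ⋃ j : J, A ∩ {x | x l ∈ Ico ((j : ℤ) * δ) (((j : ℤ) + 1) * δ)} := by
    ext x
    simp only [mem_inter_iff, mem_preimage, mem_singleton_iff, mem_iUnion, mem_ofPred_eq, hfloor]
    constructor
    · rintro ⟨hx, hc⟩
      exact ⟨⟨_, mem_image_of_mem _ hx, hc⟩, hx, rfl⟩
    · rintro ⟨⟨j, -, hc⟩, hx, rfl⟩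
      exact ⟨hx, hc⟩
  rw [hunion]
  exact iUnion fun j => h.inter_Ico l _ _

end IsQueryRegion

theorem JointQuery.measurableSet_regions {d M : ℕ} {𝒳 : Set (Fin d → ℝ)} (A : JointQuery 𝒳 M)
    (m : Fin M) : MeasurableSet (A.regions m) :=
  (A m).2.measurableSet

theorem exists_monotone_queryRegion {d : ℕ} (𝒳 : Set (Fin d → ℝ)) :
    ∃ R : ℕ → Set (Fin d → ℝ), Monotone R ∧ (∀ n, IsQueryRegion 𝒳 (R n)) ∧
      interior 𝒳 ⊆ ⋃ n, R n := by
  classical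
  obtain ⟨f, hf⟩ := exists_surjective_nat ((Fin d → ℚ) × (Fin d → ℚ))
  let box (n : ℕ) : Set (Fin d → ℝ) := rect (fun l => ((f n).1 l : ℝ)) fun l => ((f n).2 l : ℝ)
  let s (n : ℕ) : Set (Fin d → ℝ) := if box n ⊆ 𝒳 then box n else ∅
  have hs : ∀ n, IsQueryRegion 𝒳 (s n) := fun n => by
    by_cases hn : box n ⊆ 𝒳
    · simpa only [s, if_pos hn] using IsQueryRegion.of_rect hn
    · simpa only [s, if_neg hn] using IsQueryRegion.empty
  refine ⟨accumulate s, monotone_accumulate, fun n => ?_, fun x hx => ?_⟩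
  · have haccumulate : accumulate s n = ⋃ k : Fin (n + 1), s k := by
      ext x
      simp [accumulate, Fin.exists_iff]
    rw [haccumulate]
    exact IsQueryRegion.iUnion fun k => hs k
  · obtain ⟨a, b, hxab, hab⟩ := exists_rat_rect isOpen_interior hx
    obtain ⟨n, hn⟩ := hf (a, b)
    have hbox : s n = rect (fun l => (a l : ℝ)) fun l => (b l : ℝ) := by
      have hsub : box n ⊆ 𝒳 := by simpa only [box, hn] using hab.trans interior_subset
      simp only [s, if_pos hsub, box, hn]
    rw [iUnion_accumulate]
    exact mem_iUnion.2 ⟨n, hbox ▸ hxab⟩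

theorem exists_queryRegion_tendsto_setIntegral {d : ℕ} {E : Type*} [NormedAddCommGroup E]
    [NormedSpace ℝ E] {𝒳 : Set (Fin d → ℝ)} (h𝒳 : volume (frontier 𝒳) = 0) :
    ∃ R : ℕ → Set (Fin d → ℝ), (∀ n, IsQueryRegion 𝒳 (R n)) ∧
      ∀ φ : (Fin d → ℝ) → E, Integrable φ → (∀ x ∉ 𝒳, φ x = 0) →
        Tendsto (fun n => ∫ x in R n, φ x) atTop (𝓝 (∫ x, φ x)) := by
  obtain ⟨R, hmono, hR, hcover⟩ := exists_monotone_queryRegion 𝒳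
  refine ⟨R, hR, fun φ hφ hoff => ?_⟩
  have hlim := tendsto_setIntegral_of_monotone (fun n => (hR n).measurableSet) hmono
    hφ.integrableOn
  suffices hzero : ∀ᵐ x, x ∉ ⋃ n, R n → φ x = 0 by
    rwa [setIntegral_eq_integral_of_ae_compl_eq_zero hzero] at hlim
  filter_upwards [measure_eq_zero_iff_ae_notMem.1 h𝒳] with x hx hxR
  exact hoff x fun hx𝒳 => hx ⟨subset_closure hx𝒳, fun hint => hxR (hcover hint)⟩

/-! ### The value of the maximal gain -/

/-- The density at `x` of the event that the target is `x` and the players, asked questions whose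
true answers are `i`, respond with `y`. -/
noncomputable def responseDensity {d M : ℕ} (p : Param d M → ℝ) (i y : Resp M)
    (x : Fin d → ℝ) : ℝ :=
  ∫ e, bscProd e i y * p (x, e)

/-- The joint query of the fine strips orthogonal to the `l`-th axis, cut down to `R`: residue
classes are numbered by response vectors through `E`, and player `m` is asked for the `m`-th bit of
the class of the strip containing the target. -/
def stripQuery {d M : ℕ} (R : Set (Fin d → ℝ)) (E : ZMod (2 ^ M) ≃ Resp M) (l : Fin d) (δ : ℝ)
    (m : Fin M) : Set (Fin d → ℝ) :=
  ⋃ c : {c : ZMod (2 ^ M) // E c m = true}, R ∩ stripIndex l (2 ^ M) δ ⁻¹' {c.1}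

section StripQuery

variable {d M : ℕ} {R : Set (Fin d → ℝ)} (E : ZMod (2 ^ M) ≃ Resp M) (l : Fin d) {δ : ℝ}

theorem isQueryRegion_stripQuery {𝒳 : Set (Fin d → ℝ)} (hR : IsQueryRegion 𝒳 R) (hδ : 0 < δ)
    (m : Fin M) : IsQueryRegion 𝒳 (stripQuery R E l δ m) :=
  IsQueryRegion.iUnion fun c => hR.inter_stripIndex_fiber l hδ c.1

theorem answers_stripQuery_of_mem {x : Fin d → ℝ} (hx : x ∈ R) :
    answers (stripQuery R E l δ) x = E (stripIndex l (2 ^ M) δ x) := by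
  funext m
  rw [Bool.eq_iff_iff]
  simp [answers, stripQuery, hx]

theorem answers_stripQuery_of_notMem {x : Fin d → ℝ} (hx : x ∉ R) :
    answers (stripQuery R E l δ) x = fun _ => false := by
  funext m
  simp [answers, stripQuery, hx]

end StripQuery

namespace IsPriorDensity

variable {d M : ℕ} {𝒳 R : Set (Fin d → ℝ)} {p : Param d M → ℝ}

theorem integrable_bscProd_mul (hp : IsPriorDensity 𝒳 p) (i y : Resp M) :
    Integrable fun θ : Param d M => bscProd θ.2 i y * p θ :=
  integrable_mul_of_mem_Icc_on_support hp.integrable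
    ((measurable_bscProd i y).comp measurable_snd) fun _ hθ =>
      ⟨(bscProd_pos (hp.mem_of_ne_zero hθ).2 i y).le, bscProd_le_one (hp.mem_of_ne_zero hθ).2 i y⟩

theorem integrable_responseDensity (hp : IsPriorDensity 𝒳 p) (i y : Resp M) :
    Integrable (responseDensity p i y) :=
  (hp.integrable_bscProd_mul i y).integral_prod_left

theorem responseDensity_eq_zero (hp : IsPriorDensity 𝒳 p) (i y : Resp M) {x : Fin d → ℝ}
    (hx : x ∉ 𝒳) : responseDensity p i y x = 0 := by
  have hpx : ∀ e, p (x, e) = 0 := fun e => hp.eq_zero _ fun h => hx h.1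
  simp [responseDensity, hpx]

theorem sum_integral_responseDensity (hp : IsPriorDensity 𝒳 p) (y : Resp M) :
    ∑ i, ∫ x, responseDensity p i y x = 1 := by
  have hfubini : ∀ i, ∫ x, responseDensity p i y x = ∫ θ : Param d M, bscProd θ.2 i y * p θ :=
    fun i => (integral_prod _ (hp.integrable_bscProd_mul i y)).symm
  simp only [hfubini]
  rw [← integral_finsetSum _ fun i _ => hp.integrable_bscProd_mul i y]
  simp only [← Finset.sum_mul, bscProd_comm _ _ y, sum_bscProd, one_mul]
  exact hp.integral_eq_one

theorem predictive_stripQuery (hp : IsPriorDensity 𝒳 p) (hR : IsQueryRegion 𝒳 R)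
    (E : ZMod (2 ^ M) ≃ Resp M) (l : Fin d) {δ : ℝ} (hδ : 0 < δ) (y : Resp M) :
    predictive p (stripQuery R E l δ) y
      = (∑ c, ∫ x in stripIndex l (2 ^ M) δ ⁻¹' {c}, R.indicator (responseDensity p (E c) y) x)
        + ∫ x in Rᶜ, responseDensity p (fun _ => false) y x := by
  have hint : Integrable fun θ => likelihood (stripQuery R E l δ) y θ * p θ :=
    hp.integrable_likelihood_mul (fun m => (isQueryRegion_stripQuery E l hR hδ m).measurableSet) y
  have hint_x : Integrable fun x => responseDensity p (answers (stripQuery R E l δ) x) y x :=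
    hint.integral_prod_left
  have hfubini : predictive p (stripQuery R E l δ) y
      = ∫ x, responseDensity p (answers (stripQuery R E l δ) x) y x := integral_prod _ hint
  rw [hfubini, ← integral_add_compl hR.measurableSet hint_x, ← integral_indicator hR.measurableSet,
    ← sum_setIntegral_fiber (measurableSet_stripIndex_fiber (q := 2 ^ M) l δ)
      (hint_x.indicator hR.measurableSet)]
  congr 1
  · refine Finset.sum_congr rfl fun c _ =>
      setIntegral_congr_fun (measurableSet_stripIndex_fiber l δ c) fun x hxc => ?_
    by_cases hx : x ∈ R
    · simp only [indicator_of_mem hx, answers_stripQuery_of_mem E l hx, eq_of_mem_singleton hxc]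
    · simp only [indicator_of_notMem hx]
  · refine setIntegral_congr_fun hR.measurableSet.compl fun x hx => ?_
    simp only [answers_stripQuery_of_notMem E l hx]

theorem tendsto_predictive_stripQuery (hp : IsPriorDensity 𝒳 p) (hR : IsQueryRegion 𝒳 R)
    (E : ZMod (2 ^ M) ≃ Resp M) (l : Fin d) :
    Tendsto (fun δ => predictive p (stripQuery R E l δ)) (𝓝[>] 0)
      (𝓝 fun y => ((2 ^ M : ℕ) : ℝ)⁻¹ * (∑ i, ∫ x in R, responseDensity p i y x)
        + ∫ x in Rᶜ, responseDensity p (fun _ => false) y x) := by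
  refine tendsto_pi_nhds.2 fun y => ?_
  have hstrips := tendsto_finsetSum Finset.univ fun (c : ZMod (2 ^ M)) _ =>
    tendsto_setIntegral_stripIndex l
      ((hp.integrable_responseDensity (E c) y).indicator hR.measurableSet) c
  simp only [integral_indicator (μ := volume) hR.measurableSet, smul_eq_mul, ← Finset.mul_sum,
    E.sum_comp fun i => ∫ x in R, responseDensity p i y x] at hstrips
  refine (hstrips.add_const (∫ x in Rᶜ, responseDensity p (fun _ => false) y x)).congr' ?_
  filter_upwards [self_mem_nhdsWithin] with δ hδ
  exact (hp.predictive_stripQuery hR E l hδ y).symm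

theorem uniform_mem_closure_range_predictive (hp : IsPriorDensity 𝒳 p) (hd : 0 < d)
    (h𝒳 : volume (frontier 𝒳) = 0) :
    (fun _ => (Fintype.card (Resp M) : ℝ)⁻¹)
      ∈ closure (range fun A : JointQuery 𝒳 M => predictive p A.regions) := by
  obtain ⟨R, hR, hlim⟩ := exists_queryRegion_tendsto_setIntegral (E := ℝ) h𝒳
  have hcard : Fintype.card (Resp M) = 2 ^ M := by simp
  let E : ZMod (2 ^ M) ≃ Resp M := Fintype.equivOfCardEq (by rw [ZMod.card, hcard])
  have hR_lim : ∀ i y, Tendsto (fun n => ∫ x in R n, responseDensity p i y x) atTop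
      (𝓝 (∫ x, responseDensity p i y x)) := fun i y =>
    hlim _ (hp.integrable_responseDensity i y) fun x => hp.responseDensity_eq_zero i y
  have hRc_lim : ∀ i y, Tendsto (fun n => ∫ x in (R n)ᶜ, responseDensity p i y x) atTop (𝓝 0) := by
    intro i y
    simp only [setIntegral_compl (hR _).measurableSet (hp.integrable_responseDensity i y)]
    simpa only [sub_self] using (hR_lim i y).const_sub (∫ x, responseDensity p i y x)
  have hmem : ∀ n, (fun y => ((2 ^ M : ℕ) : ℝ)⁻¹ * (∑ i, ∫ x in R n, responseDensity p i y x)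
      + ∫ x in (R n)ᶜ, responseDensity p (fun _ => false) y x)
        ∈ closure (range fun A : JointQuery 𝒳 M => predictive p A.regions) := fun n =>
    mem_closure_of_tendsto (hp.tendsto_predictive_stripQuery (hR n) E ⟨0, hd⟩) <| by
      filter_upwards [self_mem_nhdsWithin] with δ hδ
      exact ⟨fun m => ⟨_, isQueryRegion_stripQuery E ⟨0, hd⟩ (hR n) hδ m⟩, rfl⟩
  refine isClosed_closure.mem_of_tendsto (b := atTop) (tendsto_pi_nhds.2 fun y => ?_)
    (.of_forall hmem)
  simpa only [hp.sum_integral_responseDensity, mul_one, add_zero, hcard] using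
    ((tendsto_finsetSum Finset.univ fun i _ => hR_lim i y).const_mul ((2 ^ M : ℕ) : ℝ)⁻¹).add
      (hRc_lim (fun _ => false) y)

theorem isLUB_entropyLoss (hp : IsPriorDensity 𝒳 p) (hd : 0 < d) (h𝒳 : volume (frontier 𝒳) = 0) :
    IsLUB (range fun A : JointQuery 𝒳 M => entropyLoss p A.regions) (meanCapacity p) := by
  refine ⟨?_, fun b hb => ?_⟩
  · rintro _ ⟨A, rfl⟩
    exact hp.entropyLoss_le_meanCapacity A.measurableSet_regions
  · let loss (q : Resp M → ℝ) : ℝ := shannonEntropy q - M + meanCapacity p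
    have hclosed : IsClosed {q | loss q ≤ b} :=
      isClosed_le ((continuous_shannonEntropy.sub continuous_const).add continuous_const)
        continuous_const
    have hrange : range (fun A : JointQuery 𝒳 M => predictive p A.regions) ⊆ {q | loss q ≤ b} := by
      rintro _ ⟨A, rfl⟩
      exact (hp.entropyLoss_eq_add_meanCapacity A.measurableSet_regions).ge.trans (hb ⟨A, rfl⟩)
    have huniform : loss (fun _ => (Fintype.card (Resp M) : ℝ)⁻¹) ≤ b :=
      closure_minimal hrange hclosed (hp.uniform_mem_closure_range_predictive hd h𝒳)
    simpa only [loss, shannonEntropy_const_inv_card, logb_card_resp, sub_self, zero_add]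
      using huniform

theorem maxGain_eq (hp : IsPriorDensity 𝒳 p) (hd : 0 < d) (h𝒳 : volume (frontier 𝒳) = 0) :
    maxGain 𝒳 p = meanCapacity p := by
  have : Nonempty (JointQuery 𝒳 M) := ⟨fun _ => ⟨∅, IsQueryRegion.empty⟩⟩
  exact (hp.isLUB_entropyLoss hd h𝒳).ciSup_eq

end IsPriorDensity

/-! ### Marginal densities of the crossover probabilities -/

/-- The vector with `m`-th coordinate `t` and the other coordinates given by `η`, which is the
argument of the density in `epsMarginal`. -/
def insertCoord {ι : Type*} [DecidableEq ι] (m : ι) (t : ℝ) (η : {k : ι // k ≠ m} → ℝ) : ι → ℝ :=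
  fun k => if hk : k = m then t else η ⟨k, hk⟩

theorem measurable_insertCoord {ι : Type*} [DecidableEq ι] (m : ι) :
    Measurable fun z : ℝ × ({k : ι // k ≠ m} → ℝ) => insertCoord m z.1 z.2 :=
  measurable_pi_iff.2 fun k => by
    unfold insertCoord
    split_ifs <;> fun_prop

theorem insertCoord_mem_univ_pi_iff {ι : Type*} [DecidableEq ι] {m : ι} {t : ℝ}
    {η : {k : ι // k ≠ m} → ℝ} {s : ι → Set ℝ} :
    insertCoord m t η ∈ univ.pi s ↔ t ∈ s m ∧ η ∈ univ.pi fun k : {k : ι // k ≠ m} => s k := by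
  simp only [mem_univ_pi, insertCoord]
  refine ⟨fun h => ⟨by simpa using h m, fun k => by simpa [k.2] using h k⟩, fun h k => ?_⟩
  split_ifs with hk
  exacts [hk ▸ h.1, h.2 ⟨k, hk⟩]

theorem measurePreserving_insertCoord {ι : Type*} [Fintype ι] [DecidableEq ι] (m : ι) :
    MeasurePreserving fun z : ℝ × ({k : ι // k ≠ m} → ℝ) => insertCoord m z.1 z.2 := by
  refine ⟨measurable_insertCoord m, (Measure.pi_eq fun s hs => ?_).symm⟩
  have hbox : (fun z : ℝ × ({k : ι // k ≠ m} → ℝ) => insertCoord m z.1 z.2) ⁻¹' univ.pi s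
      = s m ×ˢ univ.pi fun k : {k : ι // k ≠ m} => s k :=
    Set.ext fun _ => insertCoord_mem_univ_pi_iff
  rw [Measure.map_apply (measurable_insertCoord m) (MeasurableSet.univ_pi hs), hbox,
    Measure.volume_eq_prod, Measure.prod_prod, volume_pi_pi,
    Fintype.prod_eq_mul_prod_subtype_ne _ m]

theorem measurePreserving_param_insertCoord {d M : ℕ} (m : Fin M) :
    MeasurePreserving fun z : ℝ × (Fin d → ℝ) × ({k : Fin M // k ≠ m} → ℝ) =>
      ((z.2.1, insertCoord m z.1 z.2.2) : Param d M) := by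
  have hswap : MeasurePreserving fun z : ℝ × (Fin d → ℝ) × ({k : Fin M // k ≠ m} → ℝ) =>
      (z.2.1, z.1, z.2.2) :=
    (measurePreserving_prodAssoc volume volume volume).comp
      ((Measure.measurePreserving_swap.prod (MeasurePreserving.id volume)).comp
        (measurePreserving_prodAssoc volume volume volume).symm)
  exact ((MeasurePreserving.id volume).prod (measurePreserving_insertCoord m)).comp hswap

theorem integral_mul_epsMarginal {d M : ℕ} {p : Param d M → ℝ} {m : Fin M} {F : ℝ → ℝ}
    (hF : Integrable fun θ : Param d M => F (θ.2 m) * p θ) :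
    ∫ t, F t * epsMarginal p m t = ∫ θ, F (θ.2 m) * p θ := by
  have hmp := measurePreserving_param_insertCoord (d := d) m
  have hint := hmp.integrable_comp_of_integrable hF
  have hchange := integral_map hmp.aemeasurable (hmp.map_eq.symm ▸ hF.aestronglyMeasurable)
  rw [hmp.map_eq] at hchange
  simp only [Function.comp_def, insertCoord, dite_true] at hint hchange
  rw [hchange, Measure.volume_eq_prod, integral_prod _ hint]
  refine integral_congr_ae ?_
  filter_upwards [hint.prod_right_ae] with t ht
  rw [Measure.volume_eq_prod, integral_prod _ ht]
  simp only [integral_const_mul]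
  rfl

theorem IsPriorDensity.epsMarginal_eq_zero {d M : ℕ} {𝒳 : Set (Fin d → ℝ)} {p : Param d M → ℝ}
    (hp : IsPriorDensity 𝒳 p) (m : Fin M) {t : ℝ} (ht : t ∉ Ioo (0 : ℝ) (1 / 2)) :
    epsMarginal p m t = 0 := by
  have hzero : ∀ x (η : {k : Fin M // k ≠ m} → ℝ), p (x, insertCoord m t η) = 0 := fun x η =>
    hp.eq_zero _ fun h => ht <| by simpa [insertCoord] using h.2 m
  unfold insertCoord at hzero
  simp only [epsMarginal, hzero, integral_zero]

theorem IsPriorDensity.setIntegral_capacity_mul_epsMarginal {d M : ℕ} {𝒳 : Set (Fin d → ℝ)}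
    {p : Param d M → ℝ} (hp : IsPriorDensity 𝒳 p) (m : Fin M) :
    ∫ t in Ioo (0 : ℝ) (1 / 2), bscCapacity t * epsMarginal p m t
      = ∫ θ, bscCapacity (θ.2 m) * p θ := by
  rw [setIntegral_eq_integral_of_forall_compl_eq_zero fun t ht => by
    rw [hp.epsMarginal_eq_zero m ht, mul_zero]]
  exact integral_mul_epsMarginal (hp.integrable_capacity_mul m)

/-! ### The observed process -/

section Posterior

variable {d M : ℕ} {𝒳 : Set (Fin d → ℝ)} {p₀ : Param d M → ℝ}

protected theorem IsPriorDensity.jointPosterior (hp₀ : IsPriorDensity 𝒳 p₀) (ζ : Policy 𝒳 M) :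
    ∀ (n : ℕ) (h : Fin n → Resp M), IsPriorDensity 𝒳 (jointPosterior p₀ ζ n h)
  | 0, _ => hp₀
  | n + 1, h => (hp₀.jointPosterior ζ n (Fin.init h)).bayesUpdate
      (JointQuery.measurableSet_regions _) _

theorem jointPosterior_snoc (p₀ : Param d M → ℝ) (ζ : Policy 𝒳 M) (n : ℕ) (h : Fin n → Resp M)
    (y : Resp M) :
    jointPosterior p₀ ζ (n + 1) (Fin.snoc h y : Fin (n + 1) → Resp M)
      = bayesUpdate (jointPosterior p₀ ζ n h) (ζ n h).regions y := by
  rw [jointPosterior, Fin.init_snoc, Fin.snoc_last]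

/-- The probability that the first `n` responses are `h` under the policy `ζ`, by the chain rule. -/
noncomputable def historyProb (p₀ : Param d M → ℝ) (ζ : Policy 𝒳 M) :
    (n : ℕ) → (Fin n → Resp M) → ℝ
  | 0, _ => 1
  | n + 1, h => historyProb p₀ ζ n (Fin.init h)
      * predictive (jointPosterior p₀ ζ n (Fin.init h)) (ζ n (Fin.init h)).regions (h (Fin.last n))

theorem historyProb_snoc (p₀ : Param d M → ℝ) (ζ : Policy 𝒳 M) (n : ℕ) (h : Fin n → Resp M)
    (y : Resp M) :
    historyProb p₀ ζ (n + 1) (Fin.snoc h y : Fin (n + 1) → Resp M)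
      = historyProb p₀ ζ n h * predictive (jointPosterior p₀ ζ n h) (ζ n h).regions y := by
  rw [historyProb, Fin.init_snoc, Fin.snoc_last]

theorem IsPriorDensity.predictive_mul_jointPosterior_snoc (hp₀ : IsPriorDensity 𝒳 p₀)
    (ζ : Policy 𝒳 M) (n : ℕ) (h : Fin n → Resp M) (y : Resp M) (θ : Param d M) :
    predictive (jointPosterior p₀ ζ n h) (ζ n h).regions y
        * jointPosterior p₀ ζ (n + 1) (Fin.snoc h y : Fin (n + 1) → Resp M) θ
      = likelihood (ζ n h).regions y θ * jointPosterior p₀ ζ n h θ := by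
  have hpos := (hp₀.jointPosterior ζ n h).predictive_pos (ζ n h).measurableSet_regions y
  rw [jointPosterior_snoc, bayesUpdate, mul_div_cancel₀ _ hpos.ne']

end Posterior

section History

variable {M : ℕ} {Ω : Type*} {Y : ℕ → Ω → Resp M}

theorem history_succ (Y : ℕ → Ω → Resp M) (n : ℕ) (ω : Ω) :
    history Y (n + 1) ω = (Fin.snoc (history Y n ω) (Y (n + 1) ω) : Fin (n + 1) → Resp M) :=
  (Fin.snoc_init_self (history Y (n + 1) ω)).symm

theorem history_succ_preimage_snoc (Y : ℕ → Ω → Resp M) (n : ℕ) (h : Fin n → Resp M)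
    (y : Resp M) :
    history Y (n + 1) ⁻¹' {(Fin.snoc h y : Fin (n + 1) → Resp M)}
      = Y (n + 1) ⁻¹' {y} ∩ history Y n ⁻¹' {h} := by
  ext ω
  simp only [mem_preimage, mem_singleton_iff, mem_inter_iff, history_succ, Fin.snoc_inj, and_comm]

theorem measurable_history [MeasurableSpace Ω] (hY : ∀ n, Measurable (Y n)) (n : ℕ) :
    Measurable (history Y n) :=
  measurable_pi_iff.2 fun _ => hY _

theorem integrable_comp_history [MeasurableSpace Ω] {μ : Measure Ω} [IsFiniteMeasure μ]
    (hY : ∀ n, Measurable (Y n)) (n : ℕ) (φ : (Fin n → Resp M) → ℝ) :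
    Integrable (fun ω => φ (history Y n ω)) μ :=
  Integrable.of_finite.comp_measurable (measurable_history hY n)

end History

/-- The information available to the players before they answer at time `n`: the σ-algebra generated
by the target, the crossover probabilities and the responses `Y₁, …, Yₙ`. -/
abbrev paramObs {d M : ℕ} {Ω : Type*} (X : Ω → Fin d → ℝ) (eps : Ω → Fin M → ℝ)
    (Y : ℕ → Ω → Resp M) (n : ℕ) : MeasurableSpace Ω :=
  MeasurableSpace.comap (fun ω => (X ω, eps ω)) inferInstance ⊔ obs Y n

namespace IsPolicyLaw

variable {d M : ℕ} {𝒳 : Set (Fin d → ℝ)} {Ω : Type*} [MeasurableSpace Ω] {μ : Measure Ω}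
  {p₀ : Param d M → ℝ} {X : Ω → Fin d → ℝ} {eps : Ω → Fin M → ℝ} {Y : ℕ → Ω → Resp M}
  {ζ : Policy 𝒳 M} {F : Param d M → ℝ}

theorem integral_comp (hμ : IsPolicyLaw p₀ X eps Y ζ μ) (hp₀ : IsPriorDensity 𝒳 p₀)
    (hθ : Measurable fun ω => (X ω, eps ω)) (hF : Measurable F) :
    ∫ ω, F (X ω, eps ω) ∂μ = ∫ θ, F θ * p₀ θ := by
  rw [← integral_map hθ.aemeasurable hF.aestronglyMeasurable, hμ.prior,
    integral_withDensity_eq_integral_toReal_smul hp₀.measurable.ennreal_ofReal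
      (ae_of_all _ fun _ => ENNReal.ofReal_lt_top)]
  simp only [ENNReal.toReal_ofReal (hp₀.nonneg _), smul_eq_mul, mul_comm (F _)]

theorem integrable_comp (hμ : IsPolicyLaw p₀ X eps Y ζ μ) (hp₀ : IsPriorDensity 𝒳 p₀)
    (hθ : Measurable fun ω => (X ω, eps ω)) (hint : Integrable fun θ => F θ * p₀ θ) :
    Integrable (fun ω => F (X ω, eps ω)) μ := by
  refine Integrable.comp_measurable (f := fun ω => (X ω, eps ω)) (g := F) ?_ hθ
  rw [hμ.prior, integrable_withDensity_iff_integrable_smul' hp₀.measurable.ennreal_ofReal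
    (ae_of_all _ fun _ => ENNReal.ofReal_lt_top)]
  simpa only [ENNReal.toReal_ofReal (hp₀.nonneg _), smul_eq_mul, mul_comm (p₀ _)] using hint

theorem setIntegral_response (hμ : IsPolicyLaw p₀ X eps Y ζ μ)
    (hθ : Measurable fun ω => (X ω, eps ω)) (hY : ∀ n, Measurable (Y n)) (hF : Measurable F)
    (hint : Integrable (fun ω => F (X ω, eps ω)) μ) (n : ℕ) (h : Fin n → Resp M) (y : Resp M) :
    ∫ ω in Y (n + 1) ⁻¹' {y} ∩ history Y n ⁻¹' {h}, F (X ω, eps ω) ∂μ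
      = ∫ ω in history Y n ⁻¹' {h},
          likelihood (ζ n h).regions y (X ω, eps ω) * F (X ω, eps ω) ∂μ := by
  have := hμ.isProbabilityMeasure
  have hle : paramObs X eps Y n ≤ ‹MeasurableSpace Ω› :=
    sup_le hθ.comap_le (measurable_history hY n).comap_le
  have hYy : MeasurableSet (Y (n + 1) ⁻¹' {y}) := hY _ (measurableSet_singleton y)
  have hh : MeasurableSet[paramObs X eps Y n] (history Y n ⁻¹' {h}) :=
    le_sup_right (a := MeasurableSpace.comap _ _) _ ⟨{h}, measurableSet_singleton h, rfl⟩
  have hθm : Measurable[paramObs X eps Y n] fun ω => (X ω, eps ω) :=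
    (comap_measurable _).mono le_sup_left le_rfl
  have hFm : StronglyMeasurable[paramObs X eps Y n] fun ω => F (X ω, eps ω) :=
    (hF.comp hθm).stronglyMeasurable
  have hmul : (fun ω => F (X ω, eps ω)) * (Y (n + 1) ⁻¹' {y}).indicator (fun _ => (1 : ℝ))
      = (Y (n + 1) ⁻¹' {y}).indicator fun ω => F (X ω, eps ω) := by
    ext ω
    by_cases hω : ω ∈ Y (n + 1) ⁻¹' {y} <;> simp [hω]
  calc ∫ ω in Y (n + 1) ⁻¹' {y} ∩ history Y n ⁻¹' {h}, F (X ω, eps ω) ∂μ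
    _ = ∫ ω in history Y n ⁻¹' {h},
          F (X ω, eps ω) * (Y (n + 1) ⁻¹' {y}).indicator (fun _ => (1 : ℝ)) ω ∂μ := by
        rw [inter_comm, ← setIntegral_indicator hYy, ← hmul]
        rfl
    _ = ∫ ω in history Y n ⁻¹' {h}, F (X ω, eps ω)
          * (μ[(Y (n + 1) ⁻¹' {y}).indicator (fun _ => (1 : ℝ)) | paramObs X eps Y n]) ω ∂μ :=
        (setIntegral_mul_condExp hle hFm (hmul ▸ hint.indicator hYy)
          ((integrable_const 1).indicator hYy) hh).symm
    _ = _ := by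
        refine setIntegral_congr_ae (hle _ hh) ?_
        filter_upwards [hμ.response n y] with ω hω hωh
        rw [← show history Y n ω = h from hωh, mul_comm]
        exact congrArg (· * F (X ω, eps ω)) hω

theorem setIntegral_history (hμ : IsPolicyLaw p₀ X eps Y ζ μ) (hp₀ : IsPriorDensity 𝒳 p₀)
    (hθ : Measurable fun ω => (X ω, eps ω)) (hY : ∀ n, Measurable (Y n)) (hF : Measurable F)
    (hint : Integrable fun θ => F θ * p₀ θ) (n : ℕ) (h : Fin n → Resp M) :
    ∫ ω in history Y n ⁻¹' {h}, F (X ω, eps ω) ∂μ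
      = historyProb p₀ ζ n h * ∫ θ, F θ * jointPosterior p₀ ζ n h θ := by
  induction n generalizing F with
  | zero =>
    have huniv : history Y 0 ⁻¹' {h} = univ := eq_univ_of_forall fun ω => Subsingleton.elim _ _
    rw [huniv, setIntegral_univ, hμ.integral_comp hp₀ hθ hF, historyProb, one_mul]
    rfl
  | succ n ih =>
    induction h using Fin.snocCases with
    | snoc h y =>
      have hA := (ζ n h).measurableSet_regions
      have hint' : Integrable fun θ => likelihood (ζ n h).regions y θ * F θ * p₀ θ := by
        simp only [mul_assoc]
        exact integrable_mul_of_mem_Icc_on_support hint (measurable_likelihood hA y) fun θ hθ =>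
          hp₀.likelihood_mem_Icc _ y θ (right_ne_zero_of_mul hθ)
      rw [history_succ_preimage_snoc,
        hμ.setIntegral_response hθ hY hF (hμ.integrable_comp hp₀ hθ hint),
        ih (F := fun θ => likelihood (ζ n h).regions y θ * F θ)
          ((measurable_likelihood hA y).mul hF) hint', historyProb_snoc, mul_assoc,
        ← integral_const_mul (predictive _ _ y)]
      congr 2 with θ
      linear_combination -F θ * hp₀.predictive_mul_jointPosterior_snoc ζ n h y θ

theorem real_history (hμ : IsPolicyLaw p₀ X eps Y ζ μ) (hp₀ : IsPriorDensity 𝒳 p₀)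
    (hθ : Measurable fun ω => (X ω, eps ω)) (hY : ∀ n, Measurable (Y n)) (n : ℕ)
    (h : Fin n → Resp M) : μ.real (history Y n ⁻¹' {h}) = historyProb p₀ ζ n h := by
  have hone := hμ.setIntegral_history hp₀ hθ hY (F := fun _ => 1) measurable_const
    (by simpa only [one_mul] using hp₀.integrable) n h
  simpa only [setIntegral_const, smul_eq_mul, mul_one, one_mul,
    (hp₀.jointPosterior ζ n h).integral_eq_one] using hone

theorem condExp_comp (hμ : IsPolicyLaw p₀ X eps Y ζ μ) (hp₀ : IsPriorDensity 𝒳 p₀)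
    (hθ : Measurable fun ω => (X ω, eps ω)) (hY : ∀ n, Measurable (Y n)) (hF : Measurable F)
    (hint : Integrable fun θ => F θ * p₀ θ) (n : ℕ) :
    μ[fun ω => F (X ω, eps ω) | obs Y n]
      =ᵐ[μ] fun ω => ∫ θ, F θ * jointPosterior p₀ ζ n (history Y n ω) θ := by
  have := hμ.isProbabilityMeasure
  refine condExp_comap_ae_eq (measurable_history hY n) (hμ.integrable_comp hp₀ hθ hint)
    (g := fun h => ∫ θ, F θ * jointPosterior p₀ ζ n h θ) fun h => ?_
  rw [hμ.setIntegral_history hp₀ hθ hY hF hint, hμ.real_history hp₀ hθ hY]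

theorem condExp_indicator (hμ : IsPolicyLaw p₀ X eps Y ζ μ) (hp₀ : IsPriorDensity 𝒳 p₀)
    (hθ : Measurable fun ω => (X ω, eps ω)) (hY : ∀ n, Measurable (Y n)) {B : Set (Param d M)}
    (hB : MeasurableSet B) (n : ℕ) :
    μ[({ω | (X ω, eps ω) ∈ B}).indicator (fun _ => (1 : ℝ)) | obs Y n]
      =ᵐ[μ] fun ω => ∫ θ in B, jointPosterior p₀ ζ n (history Y n ω) θ := by
  have hmul : ∀ (q : Param d M → ℝ) θ, B.indicator (fun _ => (1 : ℝ)) θ * q θ = B.indicator q θ :=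
    fun q θ => by by_cases hθB : θ ∈ B <;> simp [hθB]
  have h := hμ.condExp_comp hp₀ hθ hY (F := B.indicator fun _ => 1)
    (measurable_const.indicator hB) (by simpa only [hmul] using hp₀.integrable.indicator hB) n
  simp only [hmul, integral_indicator hB] at h
  exact h

theorem condExp_capacity (hμ : IsPolicyLaw p₀ X eps Y ζ μ) (hp₀ : IsPriorDensity 𝒳 p₀)
    (hθ : Measurable fun ω => (X ω, eps ω)) (hY : ∀ n, Measurable (Y n)) (n : ℕ) (m : Fin M) :
    μ[fun ω => bscCapacity (eps ω m) | obs Y n]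
      =ᵐ[μ] fun ω => ∫ θ, bscCapacity (θ.2 m) * jointPosterior p₀ ζ n (history Y n ω) θ :=
  hμ.condExp_comp hp₀ hθ hY (F := fun θ => bscCapacity (θ.2 m))
    (continuous_bscCapacity.measurable.comp ((measurable_pi_apply m).comp measurable_snd))
    (hp₀.integrable_capacity_mul m) n

theorem condExp_sum_capacity (hμ : IsPolicyLaw p₀ X eps Y ζ μ) (hp₀ : IsPriorDensity 𝒳 p₀)
    (hθ : Measurable fun ω => (X ω, eps ω)) (hY : ∀ n, Measurable (Y n)) (n : ℕ) :
    μ[fun ω => ∑ m, bscCapacity (eps ω m) | obs Y n]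
      =ᵐ[μ] fun ω => meanCapacity (jointPosterior p₀ ζ n (history Y n ω)) :=
  hμ.condExp_comp hp₀ hθ hY (F := fun θ => ∑ m, bscCapacity (θ.2 m))
    (Finset.measurable_sum _ fun m _ => continuous_bscCapacity.measurable.comp
      ((measurable_pi_apply m).comp measurable_snd)) hp₀.integrable_sum_capacity_mul n

theorem condExp_comp_history_succ (hμ : IsPolicyLaw p₀ X eps Y ζ μ) (hp₀ : IsPriorDensity 𝒳 p₀)
    (hθ : Measurable fun ω => (X ω, eps ω)) (hY : ∀ n, Measurable (Y n)) (n : ℕ)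
    (φ : (Fin (n + 1) → Resp M) → ℝ) :
    μ[fun ω => φ (history Y (n + 1) ω) | obs Y n]
      =ᵐ[μ] fun ω => ∑ y, predictive (jointPosterior p₀ ζ n (history Y n ω))
        (ζ n (history Y n ω)).regions y * φ (Fin.snoc (history Y n ω) y) := by
  have := hμ.isProbabilityMeasure
  have hφ : Integrable (fun ω => φ (history Y (n + 1) ω)) μ := integrable_comp_history hY (n + 1) φ
  have hYm : ∀ y, MeasurableSet (Y (n + 1) ⁻¹' {y}) := fun y => hY _ (measurableSet_singleton y)
  refine condExp_comap_ae_eq (measurable_history hY n) hφ (g := fun h =>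
    ∑ y, predictive (jointPosterior p₀ ζ n h) (ζ n h).regions y * φ (Fin.snoc h y)) fun h => ?_
  rw [← sum_setIntegral_fiber hYm hφ.integrableOn, hμ.real_history hp₀ hθ hY, Finset.mul_sum]
  refine Finset.sum_congr rfl fun y _ => ?_
  rw [Measure.restrict_restrict (hYm y), ← history_succ_preimage_snoc,
    setIntegral_congr_fun (g := fun _ => φ (Fin.snoc h y))
      (measurable_history hY (n + 1) (measurableSet_singleton _)) fun ω hω => congrArg φ hω,
    setIntegral_const, hμ.real_history hp₀ hθ hY, historyProb_snoc, smul_eq_mul, mul_assoc]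

theorem sub_condExp_diffEntropy (hμ : IsPolicyLaw p₀ X eps Y ζ μ) (hp₀ : IsPriorDensity 𝒳 p₀)
    (hθ : Measurable fun ω => (X ω, eps ω)) (hY : ∀ n, Measurable (Y n)) (n : ℕ) :
    (fun ω => diffEntropy (jointPosterior p₀ ζ n (history Y n ω))) -
        μ[fun ω => diffEntropy (jointPosterior p₀ ζ (n + 1) (history Y (n + 1) ω)) | obs Y n]
      =ᵐ[μ] fun ω => entropyLoss (jointPosterior p₀ ζ n (history Y n ω))
        (ζ n (history Y n ω)).regions := by
  filter_upwards [hμ.condExp_comp_history_succ hp₀ hθ hY n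
    fun h => diffEntropy (jointPosterior p₀ ζ (n + 1) h)] with ω hω
  simp only [Pi.sub_apply, hω, jointPosterior_snoc]
  rfl

end IsPolicyLaw

/-! ### Optimal policies -/

section Shortfall

variable {d M : ℕ} {𝒳 : Set (Fin d → ℝ)} {p : Param d M → ℝ} {A : Fin M → Set (Fin d → ℝ)}

/-- The amount by which the expected entropy loss of the queries `A` falls short of the mean total
capacity of the channels, its least upper bound over all joint queries. -/
noncomputable def lossShortfall (p : Param d M → ℝ) (A : Fin M → Set (Fin d → ℝ)) : ℝ :=
  meanCapacity p - entropyLoss p A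

theorem lossShortfall_eq_zero_iff : lossShortfall p A = 0 ↔ entropyLoss p A = meanCapacity p :=
  sub_eq_zero.trans eq_comm

theorem IsPriorDensity.lossShortfall_nonneg (hp : IsPriorDensity 𝒳 p)
    (hA : ∀ m, MeasurableSet (A m)) : 0 ≤ lossShortfall p A :=
  sub_nonneg.2 (hp.entropyLoss_le_meanCapacity hA)

theorem IsPriorDensity.exists_lossShortfall_lt (hp : IsPriorDensity 𝒳 p) (hd : 0 < d)
    (h𝒳 : volume (frontier 𝒳) = 0) {δ : ℝ} (hδ : 0 < δ) :
    ∃ A : JointQuery 𝒳 M, lossShortfall p A.regions < δ := by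
  obtain ⟨_, ⟨A, rfl⟩, hA, -⟩ :=
    (hp.isLUB_entropyLoss hd h𝒳).exists_between (sub_lt_self (meanCapacity p) hδ)
  exact ⟨A, sub_lt_comm.1 hA⟩

end Shortfall

section FeedbackPolicy

variable {d M : ℕ} {𝒳 : Set (Fin d → ℝ)}

/-- The posterior density when the query at each time is chosen by applying `s` to the current
posterior density. -/
noncomputable def feedbackPosterior (s : (Param d M → ℝ) → JointQuery 𝒳 M) (p₀ : Param d M → ℝ) :
    (n : ℕ) → (Fin n → Resp M) → Param d M → ℝ
  | 0, _ => p₀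
  | n + 1, h =>
      bayesUpdate (feedbackPosterior s p₀ n (Fin.init h))
        (s (feedbackPosterior s p₀ n (Fin.init h))).regions (h (Fin.last n))

/-- The policy that chooses the query at each time by applying `s` to the current posterior
density. -/
noncomputable def feedbackPolicy (s : (Param d M → ℝ) → JointQuery 𝒳 M) (p₀ : Param d M → ℝ) :
    Policy 𝒳 M :=
  fun n h => s (feedbackPosterior s p₀ n h)

theorem jointPosterior_feedbackPolicy (s : (Param d M → ℝ) → JointQuery 𝒳 M) (p₀ : Param d M → ℝ)
    (n : ℕ) (h : Fin n → Resp M) :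
    jointPosterior p₀ (feedbackPolicy s p₀) n h = feedbackPosterior s p₀ n h := by
  induction n with
  | zero => rfl
  | succ n ih => rw [jointPosterior, feedbackPosterior, feedbackPolicy, ih]

theorem IsPriorDensity.exists_policy_lossShortfall_lt {p₀ : Param d M → ℝ}
    (hp₀ : IsPriorDensity 𝒳 p₀) (hd : 0 < d) (h𝒳 : volume (frontier 𝒳) = 0) {δ : ℝ} (hδ : 0 < δ) :
    ∃ ζ : Policy 𝒳 M, ∀ n h, lossShortfall (jointPosterior p₀ ζ n h) (ζ n h).regions < δ := by
  have hquery : ∀ p : Param d M → ℝ, ∃ A : JointQuery 𝒳 M,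
      IsPriorDensity 𝒳 p → lossShortfall p A.regions < δ := fun p => by
    by_cases hp : IsPriorDensity 𝒳 p
    · exact (hp.exists_lossShortfall_lt hd h𝒳 hδ).imp fun _ hA _ => hA
    · exact ⟨fun _ => ⟨∅, IsQueryRegion.empty⟩, fun h => absurd h hp⟩
  choose s hs using hquery
  refine ⟨feedbackPolicy s p₀, fun n h => ?_⟩
  have hpost := hp₀.jointPosterior (feedbackPolicy s p₀) n h
  rw [jointPosterior_feedbackPolicy] at hpost ⊢
  exact hs _ hpost

end FeedbackPolicy

namespace IsPolicyLaw

variable {d M : ℕ} {𝒳 : Set (Fin d → ℝ)} {Ω : Type*} [MeasurableSpace Ω] {μ : Measure Ω}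
  {p₀ : Param d M → ℝ} {X : Ω → Fin d → ℝ} {eps : Ω → Fin M → ℝ} {Y : ℕ → Ω → Resp M}
  {ζ : Policy 𝒳 M}

theorem integral_meanCapacity (hμ : IsPolicyLaw p₀ X eps Y ζ μ) (hp₀ : IsPriorDensity 𝒳 p₀)
    (hθ : Measurable fun ω => (X ω, eps ω)) (hY : ∀ n, Measurable (Y n)) (n : ℕ) :
    ∫ ω, meanCapacity (jointPosterior p₀ ζ n (history Y n ω)) ∂μ = meanCapacity p₀ := by
  have := hμ.isProbabilityMeasure
  have htower : ∀ k, ∫ ω, meanCapacity (jointPosterior p₀ ζ k (history Y k ω)) ∂μ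
      = ∫ ω, ∑ m, bscCapacity (eps ω m) ∂μ := fun k => by
    rw [← integral_congr_ae (hμ.condExp_sum_capacity hp₀ hθ hY k),
      integral_condExp (measurable_history hY k).comap_le]
  rw [htower n, ← htower 0]
  simp only [jointPosterior, integral_const, probReal_univ, one_smul]

theorem integral_diffEntropy_succ (hμ : IsPolicyLaw p₀ X eps Y ζ μ) (hp₀ : IsPriorDensity 𝒳 p₀)
    (hθ : Measurable fun ω => (X ω, eps ω)) (hY : ∀ n, Measurable (Y n)) (n : ℕ) :
    ∫ ω, diffEntropy (jointPosterior p₀ ζ (n + 1) (history Y (n + 1) ω)) ∂μ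
      = ∫ ω, diffEntropy (jointPosterior p₀ ζ n (history Y n ω)) ∂μ
        - ∫ ω, entropyLoss (jointPosterior p₀ ζ n (history Y n ω))
          (ζ n (history Y n ω)).regions ∂μ := by
  have := hμ.isProbabilityMeasure
  rw [← integral_congr_ae (hμ.sub_condExp_diffEntropy hp₀ hθ hY n),
    integral_sub' (integrable_comp_history hY n fun h => diffEntropy (jointPosterior p₀ ζ n h))
      integrable_condExp, integral_condExp (measurable_history hY n).comap_le, sub_sub_cancel]

theorem integral_diffEntropy (hμ : IsPolicyLaw p₀ X eps Y ζ μ) (hp₀ : IsPriorDensity 𝒳 p₀)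
    (hθ : Measurable fun ω => (X ω, eps ω)) (hY : ∀ n, Measurable (Y n)) (N : ℕ) :
    ∫ ω, diffEntropy (jointPosterior p₀ ζ N (history Y N ω)) ∂μ
      = diffEntropy p₀ - N * meanCapacity p₀ + ∑ n ∈ Finset.range N,
        ∫ ω, lossShortfall (jointPosterior p₀ ζ n (history Y n ω))
          (ζ n (history Y n ω)).regions ∂μ := by
  have := hμ.isProbabilityMeasure
  induction N with
  | zero => simp [jointPosterior]
  | succ N ih =>
    have hshort : ∫ ω, lossShortfall (jointPosterior p₀ ζ N (history Y N ω))
          (ζ N (history Y N ω)).regions ∂μ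
        = meanCapacity p₀ - ∫ ω, entropyLoss (jointPosterior p₀ ζ N (history Y N ω))
          (ζ N (history Y N ω)).regions ∂μ := by
      rw [← hμ.integral_meanCapacity hp₀ hθ hY N]
      exact integral_sub
        (integrable_comp_history hY N fun h => meanCapacity (jointPosterior p₀ ζ N h))
        (integrable_comp_history hY N fun h =>
          entropyLoss (jointPosterior p₀ ζ N h) (ζ N h).regions)
    rw [hμ.integral_diffEntropy_succ hp₀ hθ hY, ih, Finset.sum_range_succ, hshort]
    push_cast
    ring

theorem integral_lossShortfall_eq_zero_iff (hμ : IsPolicyLaw p₀ X eps Y ζ μ)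
    (hp₀ : IsPriorDensity 𝒳 p₀) (hY : ∀ n, Measurable (Y n)) (n : ℕ) :
    ∫ ω, lossShortfall (jointPosterior p₀ ζ n (history Y n ω)) (ζ n (history Y n ω)).regions ∂μ = 0
      ↔ ∀ᵐ ω ∂μ, entropyLoss (jointPosterior p₀ ζ n (history Y n ω)) (ζ n (history Y n ω)).regions
        = meanCapacity (jointPosterior p₀ ζ n (history Y n ω)) := by
  have := hμ.isProbabilityMeasure
  rw [integral_eq_zero_iff_of_nonneg (fun ω =>
      (hp₀.jointPosterior ζ n _).lossShortfall_nonneg (JointQuery.measurableSet_regions _))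
    (integrable_comp_history hY n fun h =>
      lossShortfall (jointPosterior p₀ ζ n h) (ζ n h).regions)]
  exact eventually_congr (ae_of_all _ fun ω => lossShortfall_eq_zero_iff)

end IsPolicyLaw

section Optimality

variable {d M : ℕ} {𝒳 : Set (Fin d → ℝ)} {Ω : Type*} [MeasurableSpace Ω] {p₀ : Param d M → ℝ}
  {X : Ω → Fin d → ℝ} {eps : Ω → Fin M → ℝ} {Y : ℕ → Ω → Resp M} {P : Policy 𝒳 M → Measure Ω}

theorem exists_policy_sum_integral_lossShortfall_le (hd : 0 < d) (h𝒳 : volume (frontier 𝒳) = 0)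
    (hp₀ : IsPriorDensity 𝒳 p₀) (hY : ∀ n, Measurable (Y n))
    (hP : ∀ ζ, IsPolicyLaw p₀ X eps Y ζ (P ζ)) (N : ℕ) {δ : ℝ} (hδ : 0 < δ) :
    ∃ ζ : Policy 𝒳 M, ∑ n ∈ Finset.range N,
      ∫ ω, lossShortfall (jointPosterior p₀ ζ n (history Y n ω))
        (ζ n (history Y n ω)).regions ∂(P ζ) ≤ δ := by
  have hN : (0 : ℝ) < N + 1 := by positivity
  obtain ⟨ζ, hζ⟩ := hp₀.exists_policy_lossShortfall_lt hd h𝒳 (div_pos hδ hN)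
  have := (hP ζ).isProbabilityMeasure
  have hle : ∀ n, ∫ ω, lossShortfall (jointPosterior p₀ ζ n (history Y n ω))
      (ζ n (history Y n ω)).regions ∂(P ζ) ≤ δ / (N + 1) := fun n => by
    have hmono := integral_mono (μ := P ζ) (integrable_comp_history hY n fun h =>
      lossShortfall (jointPosterior p₀ ζ n h) (ζ n h).regions) (integrable_const (δ / (N + 1)))
      fun ω => (hζ n (history Y n ω)).le
    simpa only [integral_const, probReal_univ, one_smul] using hmono
  refine ⟨ζ, (Finset.sum_le_card_nsmul _ _ _ fun n _ => hle n).trans ?_⟩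
  rw [Finset.card_range, nsmul_eq_mul, mul_div_left_comm]
  exact mul_le_of_le_one_right hδ.le ((div_le_one hN).2 (lt_add_one _).le)

theorem forall_integral_diffEntropy_le_iff (hd : 0 < d) (h𝒳 : volume (frontier 𝒳) = 0)
    (hp₀ : IsPriorDensity 𝒳 p₀) (hθ : Measurable fun ω => (X ω, eps ω))
    (hY : ∀ n, Measurable (Y n)) (hP : ∀ ζ, IsPolicyLaw p₀ X eps Y ζ (P ζ)) (N : ℕ)
    (ζ : Policy 𝒳 M) :
    (∀ ζ' : Policy 𝒳 M,
      ∫ ω, diffEntropy (jointPosterior p₀ ζ N (history Y N ω)) ∂(P ζ)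
        ≤ ∫ ω, diffEntropy (jointPosterior p₀ ζ' N (history Y N ω)) ∂(P ζ')) ↔
    ∀ n < N, ∀ᵐ ω ∂(P ζ),
      entropyLoss (jointPosterior p₀ ζ n (history Y n ω)) (ζ n (history Y n ω)).regions
        = meanCapacity (jointPosterior p₀ ζ n (history Y n ω)) := by
  have hnonneg : ∀ (ζ : Policy 𝒳 M), ∀ n ∈ Finset.range N,
      0 ≤ ∫ ω, lossShortfall (jointPosterior p₀ ζ n (history Y n ω))
        (ζ n (history Y n ω)).regions ∂(P ζ) := fun ζ n _ =>
    integral_nonneg fun ω =>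
      (hp₀.jointPosterior ζ n _).lossShortfall_nonneg (JointQuery.measurableSet_regions _)
  simp only [fun ζ => (hP ζ).integral_diffEntropy hp₀ hθ hY N, add_le_add_iff_left,
    ← (hP ζ).integral_lossShortfall_eq_zero_iff hp₀ hY, ← Finset.mem_range]
  rw [← Finset.sum_eq_zero_iff_of_nonneg (hnonneg ζ)]
  refine ⟨fun hmin => ?_, fun hzero ζ' => hzero.trans_le (Finset.sum_nonneg (hnonneg ζ'))⟩
  refine le_antisymm (le_of_forall_pos_le_add fun δ hδ => ?_) (Finset.sum_nonneg (hnonneg ζ))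
  obtain ⟨ζ', hζ'⟩ := exists_policy_sum_integral_lossShortfall_le hd h𝒳 hp₀ hY hP N hδ
  rw [zero_add]
  exact (hmin ζ').trans hζ'

end Optimality

theorem theorem6 {d M : ℕ} (hd : 0 < d)
    (𝒳 : Set (Fin d → ℝ)) (h𝒳 : volume (frontier 𝒳) = 0)
    (p₀ : Param d M → ℝ) (hp₀ : IsPriorDensity 𝒳 p₀)
    {Ω : Type*} [MeasurableSpace Ω]
    (X : Ω → Fin d → ℝ) (eps : Ω → Fin M → ℝ) (Y : ℕ → Ω → Resp M)
    (hX : Measurable X) (heps : Measurable eps) (hY : ∀ n, Measurable (Y n))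
    (P : Policy 𝒳 M → Measure Ω) (hP : ∀ ζ, IsPolicyLaw p₀ X eps Y ζ (P ζ)) :
    -- the densities `pₙ` are the posteriors, and `entropyLoss` is the conditional entropy loss
    (∀ (ζ : Policy 𝒳 M) (n : ℕ),
      (∀ B : Set (Param d M), MeasurableSet B →
        (P ζ)[({ω | (X ω, eps ω) ∈ B}).indicator (fun _ => (1 : ℝ)) | obs Y n]
          =ᵐ[P ζ] fun ω => ∫ θ in B, jointPosterior p₀ ζ n (history Y n ω) θ) ∧
      (fun ω => diffEntropy (jointPosterior p₀ ζ n (history Y n ω))) -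
          (P ζ)[fun ω => diffEntropy (jointPosterior p₀ ζ (n + 1) (history Y (n + 1) ω)) | obs Y n]
        =ᵐ[P ζ] fun ω => entropyLoss (jointPosterior p₀ ζ n (history Y n ω))
          (ζ n (history Y n ω)).regions) ∧
    -- part 1: the formula for the gain, and the characterization of the optimal policies
    (∀ (ζ : Policy 𝒳 M) (n : ℕ), ∀ᵐ ω ∂(P ζ),
      (∀ A : JointQuery 𝒳 M,
        entropyLoss (jointPosterior p₀ ζ n (history Y n ω)) A.regions
          = mixtureGain (jointPosterior p₀ ζ n (history Y n ω)) A.regions) ∧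
      IsLUB (range fun A : JointQuery 𝒳 M =>
          mixtureGain (jointPosterior p₀ ζ n (history Y n ω)) A.regions)
        (maxGain 𝒳 (jointPosterior p₀ ζ n (history Y n ω)))) ∧
    (∀ (N : ℕ) (ζ : Policy 𝒳 M),
      (∀ ζ' : Policy 𝒳 M,
        ∫ ω, diffEntropy (jointPosterior p₀ ζ N (history Y N ω)) ∂(P ζ)
          ≤ ∫ ω, diffEntropy (jointPosterior p₀ ζ' N (history Y N ω)) ∂(P ζ')) ↔
      ∀ n < N, ∀ᵐ ω ∂(P ζ),
        mixtureGain (jointPosterior p₀ ζ n (history Y n ω)) (ζ n (history Y n ω)).regions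
          = maxGain 𝒳 (jointPosterior p₀ ζ n (history Y n ω))) ∧
    -- part 2: the value of the maximal gain
    (∀ (ζ : Policy 𝒳 M) (n : ℕ),
      (∀ᵐ ω ∂(P ζ), maxGain 𝒳 (jointPosterior p₀ ζ n (history Y n ω))
        = ∑ m : Fin M, (P ζ)[fun ω' => bscCapacity (eps ω' m) | obs Y n] ω) ∧
      (∀ m : Fin M, (P ζ)[fun ω' => bscCapacity (eps ω' m) | obs Y n]
        =ᵐ[P ζ] fun ω => ∫ t in Ioo (0 : ℝ) (1 / 2),
          bscCapacity t * epsMarginal (jointPosterior p₀ ζ n (history Y n ω)) m t)) := by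
  have hθ : Measurable fun ω => (X ω, eps ω) := hX.prodMk heps
  have hpost : ∀ (ζ : Policy 𝒳 M) n h, IsPriorDensity 𝒳 (jointPosterior p₀ ζ n h) :=
    hp₀.jointPosterior
  have hmax : ∀ (ζ : Policy 𝒳 M) n h, maxGain 𝒳 (jointPosterior p₀ ζ n h)
      = meanCapacity (jointPosterior p₀ ζ n h) := fun ζ n h => (hpost ζ n h).maxGain_eq hd h𝒳
  have hgain : ∀ (ζ : Policy 𝒳 M) n h (A : JointQuery 𝒳 M),
      entropyLoss (jointPosterior p₀ ζ n h) A.regions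
        = mixtureGain (jointPosterior p₀ ζ n h) A.regions := fun ζ n h A =>
    (hpost ζ n h).entropyLoss_eq_mixtureGain A.measurableSet_regions
  refine ⟨fun ζ n => ⟨fun B hB => (hP ζ).condExp_indicator hp₀ hθ hY hB n,
    (hP ζ).sub_condExp_diffEntropy hp₀ hθ hY n⟩, fun ζ n => ae_of_all _ fun ω =>
      ⟨hgain ζ n _, ?_⟩, fun N ζ => ?_, fun ζ n => ⟨?_, fun m => ?_⟩⟩
  · simp only [← hgain, hmax]
    exact (hpost ζ n _).isLUB_entropyLoss hd h𝒳
  · simp only [← hgain, hmax]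
    exact forall_integral_diffEntropy_le_iff hd h𝒳 hp₀ hθ hY hP N ζ
  · filter_upwards [ae_all_iff.2 fun m => (hP ζ).condExp_capacity hp₀ hθ hY n m] with ω hω
    rw [hmax, (hpost ζ n _).meanCapacity_eq_sum]
    exact Finset.sum_congr rfl fun m _ => (hω m).symm
  · filter_upwards [(hP ζ).condExp_capacity hp₀ hθ hY n m] with ω hω
    rw [hω, (hpost ζ n _).setIntegral_capacity_mul_epsMarginal]
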